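/- \textbf{Theorem (compensation lower bound without information gap).} \emph{Setting.} Let $\mathcal A$ be a finite set of arms with feature vectors $\mathbf x_a\in\mathbb R^{d}$, $a\in\mathcal A$, that span $\mathbb R^{d}$. For a parameter $\theta\in\mathbb R^d$, arm $a$ has expected reward $\mathbf x_a^{\mathsf T}\theta$ and gap $\Delta_a=\max_{b}\mathbf x_b^{\mathsf T}\theta-\mathbf x_a^{\mathsf T}\theta$. A (possibly randomized) algorithm chooses in each round $t$ an arm $a_t$ from the past arms and rewards and an independent random seed, and the reward $r_t=\mathbf x_{a_t}^{\mathsf T}\theta+\eta_t$ is observed, where the $\eta_t$ are i.i.d. $N(0,R^2)$ with $R>0$. The algorithm is \emph{consistent} if for every $\theta\in\mathbb R^d$ and every $0<p\le 1$ its expected regret $R_\theta(T)=\sum_{t=1}^T\bigl(\max_b\mathbf x_b^{\mathsf T}\theta-\mathbf E[\mathbf x_{a_t}^{\mathsf T}\theta]\bigr)$ is $o(T^p)$ as $T\to\infty$. The user knows the same features, and before round $t$ estimates the reward of arm $a$ by ridge regression, $\hat r_{a,t}=\mathbf x_a^{\mathsf T}\bigl(\lambda I+\sum_{s<t}\mathbf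 x_{a_s}\mathbf x_{a_s}^{\mathsf T}\bigr)^{-1}\sum_{s<t}r_s\mathbf x_{a_s}$, with $\lambda>0$. Nonnegative compensations $c_{i,t}$ (offered in round $t$ for pulling arm $i$) incentivize the user to follow the algorithm if almost surely, in every round $t$, the algorithm's choice $a_t$ maximizes $i\mapsto\hat r_{i,t}+c_{i,t}$. The total compensation is $C(T)=\sum_{t=1}^T\mathbf E[c_{a_t,t}]$. \emph{Claim.} For every $R>0$ there is a constant $\kappa>0$, depending only on $R$, such that for all $d$, $\mathcal A$, $(\mathbf x_a)$ as above, every consistent algorithm, every true parameter $\theta^*\in\mathbb R^d$, every $\lambda>0$, and all compensations that incentivize the user to follow the algorithm under $\theta^*$, $$C(T)\ \ge\ \kappa\, c_x(\mathcal A,\theta^*)\log T\qquad\text{for all sufficiently large }T,$$ where, with the gaps $\Delta_a$ of $\theta^*$ and $H_\alpha=\sum_a\alpha_a\mathbf x_a\mathbf x_a^{\mathsf T}$, $$c_x(\mathcal A,\theta^*)=\inf\Bigl\{\sum_{a}\alpha_a\frac{\Delta_a}{3}\ :\ \alpha\ge 0,\ H_\alpha\text{ invertible},\ \mathbf x_a^{\mathsf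 T}H_\alpha^{-1}\mathbf x_a\le\frac{\Delta_a^2}{2}\text{ for all }a\text{ with }\Delta_a>0\Bigr\}.$$ Moreover, if the $\mathbf x_a$ are the standard basis vectors of $\mathbb R^d$ (the $K$-armed bandit, $K=d$), then $c_x(\mathcal A,\theta^*)=\sum_{a:\Delta_a>0}\frac{2}{3\Delta_a}$, and $$C(T)\ \ge\ \kappa\sum_{a:\Delta_a>0}\frac{\log T}{\Delta_a}\qquad\text{for all sufficiently large }T.$$ -/

import Mathlib

open MeasureTheory ProbabilityTheory Filter
open scoped NNReal ENNReal Matrix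

namespace IncentivizedBandit

noncomputable section

/-- A (possibly randomized) bandit algorithm on `K` arms: in round `t` (rounds are numbered from
`0`) it selects an arm as a measurable function of a random seed and of the history, i.e. the list
of the pairs (pulled arm, observed reward) of the rounds `0, …, t - 1`. -/
structure Algorithm (K : ℕ) (S : Type*) [MeasurableSpace S] where
  act : (t : ℕ) → S → (Fin t → Fin K × ℝ) → Fin K
  measurable_act : ∀ t, Measurable (fun p : S × (Fin t → Fin K × ℝ) => act t p.1 p.2)

/-- Expected reward of arm `a` in the linear bandit with features `x` and parameter `θ`. -/
def meanReward {d K : ℕ} (x : Fin K → Fin d → ℝ) (θ : Fin d → ℝ) (a : Fin K) : ℝ :=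
  x a ⬝ᵥ θ

/-- Reward gap `Δ_a` between a best arm and arm `a`. -/
def gap {d K : ℕ} (x : Fin K → Fin d → ℝ) (θ : Fin d → ℝ) (a : Fin K) : ℝ :=
  (⨆ b, meanReward x θ b) - meanReward x θ a

/-- The history before round `t` when the algorithm has seed `s`, the arms have means `m`, and the
noise in round `i` is `z i`: the arm `a` pulled in round `t` yields the reward `m a + z t`. -/
def history {K : ℕ} {S : Type*} [MeasurableSpace S] (alg : Algorithm K S) (m : Fin K → ℝ)
    (s : S) (z : ℕ → ℝ) : (t : ℕ) → Fin t → Fin K × ℝ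
  | 0 => Fin.elim0
  | t + 1 =>
    let h := history alg m s z t
    let a := alg.act t s h
    Fin.snoc h (a, m a + z t)

/-- The arm `a_t`. -/
def arm {K : ℕ} {S : Type*} [MeasurableSpace S] (alg : Algorithm K S) (m : Fin K → ℝ)
    (s : S) (z : ℕ → ℝ) (t : ℕ) : Fin K :=
  alg.act t s (history alg m s z t)

/-- The user's regularized Gram matrix `λ I + ∑ i, x_{a_i} x_{a_i}ᵀ` after the history `h`. -/
def gram {d K t : ℕ} (x : Fin K → Fin d → ℝ) (lam : ℝ) (h : Fin t → Fin K × ℝ) :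
    Matrix (Fin d) (Fin d) ℝ :=
  lam • (1 : Matrix (Fin d) (Fin d) ℝ) + ∑ i, Matrix.vecMulVec (x (h i).1) (x (h i).1)

/-- The user's least-squares (ridge) estimate of the parameter after the history `h`. -/
def ridge {d K t : ℕ} (x : Fin K → Fin d → ℝ) (lam : ℝ) (h : Fin t → Fin K × ℝ) : Fin d → ℝ :=
  (gram x lam h)⁻¹ *ᵥ ∑ i, (h i).2 • x (h i).1

/-- The user's estimate of the reward of arm `a` after the history `h`. -/
def estReward {d K t : ℕ} (x : Fin K → Fin d → ℝ) (lam : ℝ) (h : Fin t → Fin K × ℝ)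
    (a : Fin K) : ℝ :=
  x a ⬝ᵥ ridge x lam h

section Randomness

variable {d K : ℕ} {S Ω : Type*} [MeasurableSpace S] [MeasurableSpace Ω]

/-- Expected regret of the first `T` rounds; `U` is the seed and `η` the noise. -/
def regret (x : Fin K → Fin d → ℝ) (alg : Algorithm K S) (P : Measure Ω) (U : Ω → S)
    (η : ℕ → Ω → ℝ) (θ : Fin d → ℝ) (T : ℕ) : ℝ :=
  ∑ t ∈ Finset.range T, ((⨆ b, meanReward x θ b)
    - ∫ ω, meanReward x θ (arm alg (meanReward x θ) (U ω) (fun i => η i ω) t) ∂P)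

/-- Consistency on the features `x`: whatever the parameter is, the regret is `o(T ^ p)` for all
`0 < p ≤ 1`. -/
def IsConsistent (x : Fin K → Fin d → ℝ) (alg : Algorithm K S) (P : Measure Ω) (U : Ω → S)
    (η : ℕ → Ω → ℝ) : Prop :=
  ∀ θ : Fin d → ℝ, ∀ p : ℝ, 0 < p → p ≤ 1 →
    (fun T : ℕ => regret x alg P U η θ T) =o[atTop] (fun T : ℕ => (T : ℝ) ^ p)

/-- The nonnegative compensations `c t i` (offered in round `t` for pulling arm `i`) incentivize
the user to follow the algorithm: almost surely, in every round the algorithm's choice maximizes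
the user's estimated reward plus the offered compensation. -/
def Incentivizes (x : Fin K → Fin d → ℝ) (lam : ℝ) (alg : Algorithm K S) (P : Measure Ω)
    (U : Ω → S) (η : ℕ → Ω → ℝ) (θ : Fin d → ℝ) (c : ℕ → Fin K → Ω → ℝ) : Prop :=
  ∀ᵐ ω ∂P, ∀ t, (∀ i, 0 ≤ c t i ω) ∧
    ∀ i, estReward x lam (history alg (meanReward x θ) (U ω) (fun j => η j ω) t) i + c t i ω ≤
      estReward x lam (history alg (meanReward x θ) (U ω) (fun j => η j ω) t)
          (arm alg (meanReward x θ) (U ω) (fun j => η j ω) t)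
        + c t (arm alg (meanReward x θ) (U ω) (fun j => η j ω) t) ω

/-- Total compensation `C(T) = ∑_{t < T} E[c_{a_t, t}]`, possibly infinite. -/
def totalCompensation (x : Fin K → Fin d → ℝ) (alg : Algorithm K S) (P : Measure Ω) (U : Ω → S)
    (η : ℕ → Ω → ℝ) (θ : Fin d → ℝ) (c : ℕ → Fin K → Ω → ℝ) (T : ℕ) : ℝ≥0∞ :=
  ∑ t ∈ Finset.range T,
    ∫⁻ ω, ENNReal.ofReal (c t (arm alg (meanReward x θ) (U ω) (fun i => η i ω) t) ω) ∂P

end Randomness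

/-- The matrix `H = ∑ a, α_a x_a x_aᵀ`. -/
def designMatrix {d K : ℕ} (x : Fin K → Fin d → ℝ) (α : Fin K → ℝ) : Matrix (Fin d) (Fin d) ℝ :=
  ∑ a, α a • Matrix.vecMulVec (x a) (x a)

/-- Feasibility for the optimization problem: `α ≥ 0`, `H` is invertible (equivalently, positive
definite), and `‖x_a‖²_{H⁻¹} ≤ Δ_a² / 2` for every suboptimal arm `a`. -/
def Feasible {d K : ℕ} (x : Fin K → Fin d → ℝ) (θ : Fin d → ℝ) (α : Fin K → ℝ) : Prop :=
  (∀ a, 0 ≤ α a) ∧ (designMatrix x α).PosDef ∧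
    ∀ a, 0 < gap x θ a →
      x a ⬝ᵥ ((designMatrix x α)⁻¹ *ᵥ x a) ≤ gap x θ a ^ 2 / 2

/-- The optimal value `c_x(𝒜, θ)`: the infimum of `∑ a, α_a Δ_a / 3` over feasible `α`. -/
def optValue {d K : ℕ} (x : Fin K → Fin d → ℝ) (θ : Fin d → ℝ) : ℝ :=
  sInf ((fun α : Fin K → ℝ => ∑ a, α a * (gap x θ a / 3)) '' {α | Feasible x θ α})

end

end IncentivizedBandit

namespace IncentivizedBandit

noncomputable section

/-! Consistency forces exploration, and exploration must be paid for. Fix a suboptimal arm `a` and a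
shift `u` with `x a ⬝ᵥ u = 2 * gap x θ a`. Under `θ + u`, arm `a` beats by at least `gap x θ a`
every arm that was optimal under `θ` and whose mean does not move. If the information `∑ b, (x b ⬝ᵥ
u) ^ 2 * E[N_b]` were below a small multiple of `R ^ 2 * log T`, a change of measure would carry the
typical event "unmoved optimal arms fill half of the rounds" to `θ + u` with probability at least of
order `T ^ (-1/4)`. The regret there would then be of order `T ^ (3/4)`, against consistency
(`IsNoiseModel.eventually_lt_information`). Minimizing a quadratic form over the hyperplane `x a ⬝ᵥ
u = 2 * gap x θ a` turns this family of inequalities into the constraints of `Feasible`, so the pull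
counts divided by `log T` are feasible up to a constant factor, and the gap-weighted pulls are at
least of order `optValue x θ * log T` (`IsNoiseModel.eventually_optValue_le`). Since consistency
speaks of one fixed parameter at a time, uniformity in `u` needs a separate compactness argument
(`eventually_forall_lt_sum_sq`).

On the user's side, the ridge error of an arm is controlled by the arm's own number of pulls once
all noise sums are (`pulls_mul_sq_estReward_sub_le`). Noise sums of size `√(ε * log T * N_b)`
suffice: their failure probability tends to `0` for every `ε > 0`. Hence after `O(ε * log T)`
exceptional rounds, the pulled arm and some optimal arm are both estimated to within a third of the
smallest positive gap, and pulling a suboptimal arm costs at least a third of its gap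
(`le_sum_compensation`). The exceptional rounds absorb only half of the bound when `ε` is small.

The cost bound holds only on a good event, whose complement is unlikely but could carry very many
pulls. The information inequality is therefore proved for expectations restricted to events of
probability tending to one. -/

/-- The number of pulls of arm `b` in the history `h`. -/
def pulls {K t : ℕ} (h : Fin t → Fin K × ℝ) (b : Fin K) : ℝ :=
  ∑ i, if (h i).1 = b then 1 else 0

/-- The sum of the deviations of the rewards of arm `b` from `m b` in the history `h`. -/
def noise {K t : ℕ} (m : Fin K → ℝ) (h : Fin t → Fin K × ℝ) (b : Fin K) : ℝ :=
  ∑ i, if (h i).1 = b then (h i).2 - m b else 0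

/-- The log-likelihood ratio of the history `h` between the means `m + δ` and `m`, for Gaussian
rewards of variance `v`. -/
def logLik {K t : ℕ} (δ : Fin K → ℝ) (v : ℝ) (m : Fin K → ℝ) (h : Fin t → Fin K × ℝ) : ℝ :=
  (∑ b, (δ b * noise m h b - δ b ^ 2 / 2 * pulls h b)) / v

/-! ### Histories, pull counts, and their measurability. -/

section Paths

variable {K : ℕ}

lemma pulls_snoc {t : ℕ} (h : Fin t → Fin K × ℝ) (p : Fin K × ℝ) (b : Fin K) :
    pulls (Fin.snoc h p : Fin (t + 1) → Fin K × ℝ) b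
      = pulls h b + if p.1 = b then 1 else 0 := by
  unfold pulls
  rw [Fin.sum_univ_castSucc]
  simp only [Fin.snoc_castSucc, Fin.snoc_last]

lemma noise_snoc {t : ℕ} (m : Fin K → ℝ) (h : Fin t → Fin K × ℝ) (p : Fin K × ℝ) (b : Fin K) :
    noise m (Fin.snoc h p : Fin (t + 1) → Fin K × ℝ) b
      = noise m h b + if p.1 = b then p.2 - m b else 0 := by
  simp [noise, Fin.sum_univ_castSucc]

lemma logLik_snoc {t : ℕ} (δ : Fin K → ℝ) (v : ℝ) (m : Fin K → ℝ) (h : Fin t → Fin K × ℝ)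
    (p : Fin K × ℝ) :
    logLik δ v m (Fin.snoc h p : Fin (t + 1) → Fin K × ℝ)
      = logLik δ v m h + (δ p.1 * (p.2 - m p.1) - δ p.1 ^ 2 / 2) / v := by
  unfold logLik
  rw [← add_div]
  congr 1
  have : ∀ b, δ b * noise m (Fin.snoc h p : Fin (t + 1) → Fin K × ℝ) b
      - δ b ^ 2 / 2 * pulls (Fin.snoc h p : Fin (t + 1) → Fin K × ℝ) b
      = (δ b * noise m h b - δ b ^ 2 / 2 * pulls h b)
        + if p.1 = b then δ b * (p.2 - m b) - δ b ^ 2 / 2 else 0 := by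
    intro b
    rw [pulls_snoc, noise_snoc]
    split_ifs <;> ring
  rw [Finset.sum_congr rfl fun b _ => this b, Finset.sum_add_distrib]
  simp

lemma pulls_nonneg {t : ℕ} (h : Fin t → Fin K × ℝ) (b : Fin K) : 0 ≤ pulls h b :=
  Finset.sum_nonneg fun i _ => by split_ifs <;> norm_num

lemma sum_pulls {t : ℕ} (h : Fin t → Fin K × ℝ) : ∑ b, pulls h b = t := by
  simp only [pulls]
  rw [Finset.sum_comm]
  simp

lemma pulls_le {t : ℕ} (h : Fin t → Fin K × ℝ) (b : Fin K) : pulls h b ≤ t := by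
  rw [← sum_pulls h]
  exact Finset.single_le_sum (f := fun b => pulls h b) (fun b _ => pulls_nonneg h b)
    (Finset.mem_univ b)

lemma pulls_eq_natCast {t : ℕ} (h : Fin t → Fin K × ℝ) (b : Fin K) :
    ∃ n : ℕ, pulls h b = n :=
  ⟨(Finset.univ.filter fun i => (h i).1 = b).card, by simp [pulls]⟩

lemma noise_eq_zero {t : ℕ} (m : Fin K → ℝ) (h : Fin t → Fin K × ℝ) (b : Fin K)
    (hb : pulls h b = 0) : noise m h b = 0 := by
  unfold pulls at hb
  rw [Finset.sum_eq_zero_iff_of_nonneg (fun i _ => by split_ifs <;> norm_num)] at hb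
  refine Finset.sum_eq_zero fun i hi => ?_
  have := hb i hi
  split_ifs at this ⊢ with h1
  · norm_num at this
  · rfl

@[fun_prop]
lemma measurable_pulls {t : ℕ} (b : Fin K) :
    Measurable fun h : Fin t → Fin K × ℝ => pulls h b := by
  unfold pulls
  refine Finset.measurable_sum _ fun i _ => Measurable.ite ?_ measurable_const measurable_const
  exact (measurable_fst.comp (measurable_pi_apply i)) (measurableSet_singleton b)

@[fun_prop]
lemma measurable_noise {t : ℕ} (m : Fin K → ℝ) (b : Fin K) :
    Measurable fun h : Fin t → Fin K × ℝ => noise m h b := by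
  unfold noise
  refine Finset.measurable_sum _ fun i _ => Measurable.ite ?_ (by fun_prop) measurable_const
  exact (measurable_fst.comp (measurable_pi_apply i)) (measurableSet_singleton b)

@[fun_prop]
lemma measurable_logLik {t : ℕ} (δ : Fin K → ℝ) (v : ℝ) (m : Fin K → ℝ) :
    Measurable fun h : Fin t → Fin K × ℝ => logLik δ v m h := by
  unfold logLik
  fun_prop

variable {S : Type*} [MeasurableSpace S] (alg : Algorithm K S) (m : Fin K → ℝ)

lemma history_succ (s : S) (z : ℕ → ℝ) (t : ℕ) :
    history alg m s z (t + 1)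
      = Fin.snoc (history alg m s z t) (arm alg m s z t, m (arm alg m s z t) + z t) := rfl

lemma pulls_history_succ (s : S) (z : ℕ → ℝ) (t : ℕ) (b : Fin K) :
    pulls (history alg m s z (t + 1)) b
      = pulls (history alg m s z t) b + if arm alg m s z t = b then 1 else 0 := by
  rw [history_succ, pulls_snoc]

lemma pulls_history_mono (s : S) (z : ℕ → ℝ) (b : Fin K) :
    Monotone fun t => pulls (history alg m s z t) b := by
  refine monotone_nat_of_le_succ fun t => ?_
  rw [pulls_history_succ]
  split_ifs <;> simp

lemma sum_pulls_mul (s : S) (z : ℕ → ℝ) (f : Fin K → ℝ) (T : ℕ) :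
    ∑ t ∈ Finset.range T, f (arm alg m s z t)
      = ∑ b, f b * pulls (history alg m s z T) b := by
  induction T with
  | zero => simp [pulls]
  | succ T ih =>
    rw [Finset.sum_range_succ, ih]
    simp only [pulls_history_succ, mul_add, Finset.sum_add_distrib]
    simp

lemma history_prefix (s : S) (z : ℕ → ℝ) {r t : ℕ} (hrt : r ≤ t) :
    (fun i => history alg m s z t (Fin.castLE hrt i)) = history alg m s z r := by
  induction t, hrt using Nat.le_induction with
  | base => rfl
  | succ t hrt ih =>
    rw [← ih, history_succ]
    funext i
    have : Fin.castLE (hrt.trans t.le_succ) i = Fin.castSucc (Fin.castLE hrt i) := rfl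
    rw [this, Fin.snoc_castSucc]

lemma history_congr (s : S) (z z' : ℕ → ℝ) (t : ℕ) (h : ∀ i < t, z i = z' i) :
    history alg m s z t = history alg m s z' t := by
  induction t with
  | zero => rfl
  | succ t ih =>
    have := ih fun i hi => h i (hi.trans t.lt_succ_self)
    simp only [history, this, h t t.lt_succ_self]

lemma measurable_snoc {α : Type*} [MeasurableSpace α] (t : ℕ) :
    Measurable fun p : (Fin t → α) × α => (Fin.snoc p.1 p.2 : Fin (t + 1) → α) := by
  refine measurable_pi_iff.2 fun i => ?_
  induction i using Fin.lastCases with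
  | last => simpa using measurable_snd
  | cast i =>
    simp only [Fin.snoc_castSucc]
    exact (measurable_pi_apply i).comp measurable_fst

lemma measurable_step (t : ℕ) :
    Measurable fun p : (S × (Fin t → Fin K × ℝ)) × ℝ =>
      (p.1.1, (Fin.snoc p.1.2 (alg.act t p.1.1 p.1.2, m (alg.act t p.1.1 p.1.2) + p.2) :
        Fin (t + 1) → Fin K × ℝ)) := by
  have ha : Measurable fun p : (S × (Fin t → Fin K × ℝ)) × ℝ => alg.act t p.1.1 p.1.2 :=
    (alg.measurable_act t).comp measurable_fst
  have hm : Measurable fun p : (S × (Fin t → Fin K × ℝ)) × ℝ => m (alg.act t p.1.1 p.1.2) :=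
    (measurable_of_countable m).comp ha
  have hs := (measurable_snd.comp measurable_fst : Measurable
    fun p : (S × (Fin t → Fin K × ℝ)) × ℝ => p.1.2)
  exact (measurable_fst.comp measurable_fst).prodMk
    ((measurable_snoc t).comp (hs.prodMk (ha.prodMk (hm.add measurable_snd))))

lemma measurable_history (t : ℕ) :
    Measurable fun p : S × (ℕ → ℝ) => (p.1, history alg m p.1 p.2 t) := by
  induction t with
  | zero => exact measurable_fst.prodMk (measurable_pi_iff.2 fun i => i.elim0)
  | succ t ih =>
    have h2 : Measurable fun p : S × (ℕ → ℝ) => p.2 t :=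
      (measurable_pi_apply t).comp measurable_snd
    exact (measurable_step alg m t).comp (ih.prodMk h2)

lemma measurable_arm (t : ℕ) :
    Measurable fun p : S × (ℕ → ℝ) => arm alg m p.1 p.2 t :=
  (alg.measurable_act t).comp (measurable_history alg m t)

end Paths

/-! ### The Gaussian noise model and the change of measure. -/

/-- The seed `U` and the i.i.d. centred Gaussian noise `η` of standard deviation `R` of a bandit. -/
structure IsNoiseModel {S Ω : Type*} [MeasurableSpace S] [MeasurableSpace Ω] (P : Measure Ω)
    (U : Ω → S) (η : ℕ → Ω → ℝ) (R : ℝ≥0) : Prop where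
  measurable_seed : Measurable U
  measurable_noise : ∀ t, Measurable (η t)
  iIndepFun_noise : iIndepFun η P
  map_noise : ∀ t, P.map (η t) = gaussianReal 0 (R ^ 2)
  indepFun_seed : IndepFun U (fun ω t => η t ω) P

/-- The joint law of the three variables is a threefold product, which may be reassociated. -/
lemma indepFun_prodMk_of_indepFun {Ω α β γ : Type*} [MeasurableSpace Ω] [MeasurableSpace α]
    [MeasurableSpace β] [MeasurableSpace γ] {P : Measure Ω} [IsProbabilityMeasure P]
    {X : Ω → α} {Y : Ω → β} {Z : Ω → γ} (hX : Measurable X) (hY : Measurable Y)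
    (hZ : Measurable Z) (h : IndepFun X (fun ω => (Y ω, Z ω)) P) (hYZ : IndepFun Y Z P) :
    IndepFun (fun ω => (X ω, Y ω)) Z P := by
  have hXY : IndepFun X Y P := h.comp measurable_id measurable_fst
  have := Measure.isProbabilityMeasure_map (μ := P) hX.aemeasurable
  have := Measure.isProbabilityMeasure_map (μ := P) hY.aemeasurable
  have := Measure.isProbabilityMeasure_map (μ := P) hZ.aemeasurable
  rw [indepFun_iff_map_prod_eq_prod_map_map (hX.prodMk hY).aemeasurable hZ.aemeasurable,
    hXY.map_prod_eq_prod_map_map hX.aemeasurable hY.aemeasurable,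
    ← MeasurableEquiv.prodAssoc.map_measurableEquiv_injective.eq_iff,
    Measure.prodAssoc_prod, ← hYZ.map_prod_eq_prod_map_map hY.aemeasurable hZ.aemeasurable,
    ← h.map_prod_eq_prod_map_map hX.aemeasurable (hY.prodMk hZ).aemeasurable,
    Measure.map_map MeasurableEquiv.prodAssoc.measurable ((hX.prodMk hY).prodMk hZ)]
  rfl

/-- One round of the change of measure: the quotient of the two Gaussian densities is the
exponential factor. -/
lemma lintegral_gaussianReal_const_add (v : ℝ≥0) (hv : v ≠ 0) (δ : ℝ) {f : ℝ → ℝ≥0∞}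
    (hf : Measurable f) :
    ∫⁻ y, f (δ + y) ∂gaussianReal 0 v
      = ∫⁻ y, f y * ENNReal.ofReal (Real.exp ((δ * y - δ ^ 2 / 2) / v)) ∂gaussianReal 0 v := by
  have hv' : (v : ℝ) ≠ 0 := by exact_mod_cast hv
  rw [← lintegral_map (g := fun y => δ + y) hf (by fun_prop), gaussianReal_map_const_add, zero_add,
    gaussianReal_of_var_ne_zero _ hv, gaussianReal_of_var_ne_zero _ hv,
    lintegral_withDensity_eq_lintegral_mul _ (measurable_gaussianPDF _ _) hf,
    lintegral_withDensity_eq_lintegral_mul _ (measurable_gaussianPDF _ _) (by fun_prop)]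
  refine lintegral_congr fun y => ?_
  have : gaussianPDF δ v y
      = gaussianPDF 0 v y * ENNReal.ofReal (Real.exp ((δ * y - δ ^ 2 / 2) / v)) := by
    rw [gaussianPDF, gaussianPDF, ← ENNReal.ofReal_mul (gaussianPDFReal_nonneg _ _ _)]
    congr 1
    simp only [gaussianPDFReal]
    rw [mul_assoc (_)⁻¹, ← Real.exp_add]
    congr 2
    field_simp
    ring
  simp only [Pi.mul_apply]
  rw [this]
  ring

section

variable {K : ℕ} {S Ω : Type*} [MeasurableSpace S] [MeasurableSpace Ω]

/-- The history before round `t` on the sample point `ω`. -/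
abbrev hist (alg : Algorithm K S) (U : Ω → S) (η : ℕ → Ω → ℝ) (m : Fin K → ℝ) (t : ℕ) (ω : Ω) :
    Fin t → Fin K × ℝ :=
  history alg m (U ω) (fun i => η i ω) t

variable {P : Measure Ω} {U : Ω → S} {η : ℕ → Ω → ℝ} {R : ℝ≥0}
  (hM : IsNoiseModel P U η R) (alg : Algorithm K S)

include hM

lemma IsNoiseModel.measurable_path : Measurable fun ω => (U ω, fun i => η i ω) :=
  hM.measurable_seed.prodMk (measurable_pi_iff.2 hM.measurable_noise)

lemma IsNoiseModel.measurable_seed_hist (m : Fin K → ℝ) (t : ℕ) :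
    Measurable fun ω => (U ω, hist alg U η m t ω) :=
  (measurable_history alg m t).comp hM.measurable_path

lemma IsNoiseModel.measurable_hist (m : Fin K → ℝ) (t : ℕ) :
    Measurable (hist alg U η m t) :=
  measurable_snd.comp (hM.measurable_seed_hist alg m t)

lemma IsNoiseModel.measurable_arm (m : Fin K → ℝ) (t : ℕ) :
    Measurable fun ω => arm alg m (U ω) (fun i => η i ω) t :=
  (IncentivizedBandit.measurable_arm alg m t).comp hM.measurable_path

variable [IsProbabilityMeasure P]

lemma IsNoiseModel.indepFun_hist (m : Fin K → ℝ) (t : ℕ) :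
    IndepFun (fun ω => (U ω, hist alg U η m t ω)) (η t) P := by
  have hZm : Measurable fun ω (i : Finset.range t) => η i ω :=
    measurable_pi_iff.2 fun i => hM.measurable_noise i
  have h1 : IndepFun (fun ω (i : Finset.range t) => η i ω) (η t) P := by
    have := hM.iIndepFun_noise.indepFun_finset (Finset.range t) {t} (by simp) hM.measurable_noise
    exact this.comp measurable_id
      (measurable_pi_apply (⟨t, Finset.mem_singleton_self t⟩ : ({t} : Finset ℕ)))
  have hr : Measurable fun z : ℕ → ℝ => (fun i : Finset.range t => z i, z t) :=
    (measurable_pi_iff.2 fun i => measurable_pi_apply _).prodMk (measurable_pi_apply t)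
  have h2 : IndepFun U (fun ω => (fun i : Finset.range t => η i ω, η t ω)) P :=
    hM.indepFun_seed.comp measurable_id hr
  have h3 := indepFun_prodMk_of_indepFun hM.measurable_seed hZm (hM.measurable_noise t) h2 h1
  -- The history before round `t` reads only the noise of earlier rounds, so padding these finitely
  -- many values with zeros recovers it.
  have he : Measurable fun p : S × (Finset.range t → ℝ) =>
      (p.1, fun i : ℕ => if h : i ∈ Finset.range t then p.2 ⟨i, h⟩ else 0) := by
    refine measurable_fst.prodMk (measurable_pi_iff.2 fun i => ?_)
    by_cases h : i ∈ Finset.range t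
    · simp only [h, dif_pos]
      exact (measurable_pi_apply _).comp measurable_snd
    · simp only [h, dif_neg, not_false_iff]
      exact measurable_const
  have h4 := h3.comp ((measurable_history alg m t).comp he) measurable_id
  convert h4 using 1
  swap
  · rfl
  funext ω
  refine Prod.ext rfl (history_congr alg m (U ω) _ _ t fun i hi => ?_)
  simp [hi]

lemma IsNoiseModel.lintegral_hist_noise (m : Fin K → ℝ) (t : ℕ)
    {F : (S × (Fin t → Fin K × ℝ)) × ℝ → ℝ≥0∞} (hF : Measurable F) :
    ∫⁻ ω, F ((U ω, hist alg U η m t ω), η t ω) ∂P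
      = ∫⁻ ω, ∫⁻ y, F ((U ω, hist alg U η m t ω), y) ∂gaussianReal 0 (R ^ 2) ∂P := by
  have hH := hM.measurable_seed_hist alg m t
  have h := (hM.indepFun_hist alg m t).map_prod_eq_prod_map_map hH.aemeasurable
    (hM.measurable_noise t).aemeasurable
  rw [hM.map_noise t] at h
  have h1 := lintegral_map (μ := P) hF (hH.prodMk (hM.measurable_noise t))
  rw [← h1, h, lintegral_prod _ hF.aemeasurable,
    lintegral_map hF.lintegral_prod_right' hH]

/-- Change of measure: the law of the history under the means `m + δ` has the density
`exp (logLik δ (R ^ 2) m ·)` with respect to its law under the means `m`. -/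
lemma IsNoiseModel.lintegral_hist_add (hR : R ≠ 0) (m δ : Fin K → ℝ) (t : ℕ)
    {F : S × (Fin t → Fin K × ℝ) → ℝ≥0∞} (hF : Measurable F) :
    ∫⁻ ω, F (U ω, hist alg U η (fun b => m b + δ b) t ω) ∂P
      = ∫⁻ ω, F (U ω, hist alg U η m t ω)
          * ENNReal.ofReal (Real.exp (logLik δ (R ^ 2 : ℝ) m (hist alg U η m t ω))) ∂P := by
  induction t with
  | zero => simp [logLik, pulls, noise, history]
  | succ t ih =>
    have hR2 : R ^ 2 ≠ 0 := pow_ne_zero 2 hR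
    have e1 := hM.lintegral_hist_noise alg (fun b => m b + δ b) t
      (hF.comp (measurable_step alg (fun b => m b + δ b) t))
    have hδa : Measurable fun p : (S × (Fin t → Fin K × ℝ)) × ℝ => δ (alg.act t p.1.1 p.1.2) :=
      (measurable_of_countable δ).comp ((alg.measurable_act t).comp measurable_fst)
    have hG : Measurable fun q : S × (Fin t → Fin K × ℝ) => ∫⁻ y, F (q.1,
        (Fin.snoc q.2 (alg.act t q.1 q.2, m (alg.act t q.1 q.2) + δ (alg.act t q.1 q.2) + y) :
          Fin (t + 1) → Fin K × ℝ)) ∂gaussianReal 0 (R ^ 2) :=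
      (hF.comp (measurable_step alg (fun b => m b + δ b) t)).lintegral_prod_right'
    have e2 := ih hG
    have hll : Measurable fun p : (S × (Fin t → Fin K × ℝ)) × ℝ => logLik δ (R ^ 2 : ℝ) m p.1.2 :=
      (measurable_logLik δ _ m).comp (measurable_snd.comp measurable_fst)
    have hL : Measurable fun p : (S × (Fin t → Fin K × ℝ)) × ℝ =>
        ENNReal.ofReal (Real.exp (logLik δ (R ^ 2 : ℝ) m p.1.2 +
          (δ (alg.act t p.1.1 p.1.2) * p.2 - δ (alg.act t p.1.1 p.1.2) ^ 2 / 2) / (R ^ 2 : ℝ))) := by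
      exact (hll.add (((hδa.mul measurable_snd).sub ((hδa.pow_const 2).div_const 2)).div_const
        _)).exp.ennreal_ofReal
    have e3 := hM.lintegral_hist_noise alg m t ((hF.comp (measurable_step alg m t)).mul hL)
    have e4 : ∀ ω, F (U ω, hist alg U η m (t + 1) ω) * ENNReal.ofReal
          (Real.exp (logLik δ (R ^ 2 : ℝ) m (hist alg U η m (t + 1) ω)))
        = F (U ω, hist alg U η m (t + 1) ω) * ENNReal.ofReal
          (Real.exp (logLik δ (R ^ 2 : ℝ) m (hist alg U η m t ω)
            + (δ (arm alg m (U ω) (fun i => η i ω) t) * η t ω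
              - δ (arm alg m (U ω) (fun i => η i ω) t) ^ 2 / 2) / (R ^ 2 : ℝ))) := by
      intro ω
      simp only [hist, history_succ, logLik_snoc, add_sub_cancel_left]
    refine e1.trans (e2.trans (Eq.trans ?_ (e3.symm.trans (lintegral_congr e4).symm)))
    -- Given the past, its likelihood ratio is a constant factor in the integral over the new noise,
    -- where the new mean shifts the Gaussian by `δ a`.
    refine lintegral_congr fun ω => ?_
    refine (lintegral_mul_const _ ((hF.comp (measurable_step alg (fun b => m b + δ b) t)).comp
      (measurable_prodMk_left (x := (U ω, hist alg U η m t ω))))).symm.trans ?_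
    set u := U ω
    set h := hist alg U η m t ω
    set a := alg.act t u h
    have hf : Measurable fun y : ℝ => F (u, (Fin.snoc h (a, m a + y) : Fin (t + 1) → Fin K × ℝ))
        * ENNReal.ofReal (Real.exp (logLik δ (R ^ 2 : ℝ) m h)) :=
      ((hF.comp (measurable_step alg m t)).comp
        (measurable_prodMk_left (x := (u, h)))).mul_const _
    have e5 := lintegral_gaussianReal_const_add (R ^ 2) hR2 (δ a) hf
    simp only [Function.comp_def, Pi.mul_apply]
    simp only [← add_assoc] at e5
    refine e5.trans (lintegral_congr fun y => ?_)
    rw [mul_assoc, ← ENNReal.ofReal_mul (Real.exp_pos _).le, ← Real.exp_add]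
    simp [a, u, h]

end

/-! ### A maximal inequality for the likelihood ratio, noise control, and transfer of events. -/

lemma quarter_add_half_le {β w y : ℝ} (hw : β / 2 ≤ w) (hw' : w ≤ β)
    (hy : 0 ≤ y) (h : β * w ≤ y ^ 2) : β / 4 ≤ y - w / 2 := by
  have : β / 4 + w / 2 ≤ y := by
    refine le_of_sq_le_sq ?_ hy
    nlinarith [mul_nonneg (sub_nonneg.2 hw) (sub_nonneg.2 hw')]
  linarith

section

variable {K : ℕ}

lemma logLik_single {t : ℕ} (b : Fin K) (x v : ℝ) (m : Fin K → ℝ) (h : Fin t → Fin K × ℝ) :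
    logLik (Pi.single b x) v m h = (x * noise m h b - x ^ 2 / 2 * pulls h b) / v := by
  unfold logLik
  congr 1
  rw [Finset.sum_eq_single b]
  · simp
  · intro c _ hc
    simp [hc]
  · simp

lemma logLik_neg {t : ℕ} (δ : Fin K → ℝ) (v : ℝ) (m : Fin K → ℝ) (h : Fin t → Fin K × ℝ) :
    logLik (-δ) v m h = -logLik δ v m h - (∑ b, δ b ^ 2 * pulls h b) / v := by
  unfold logLik
  rw [← neg_div, ← sub_div, ← Finset.sum_neg_distrib, ← Finset.sum_sub_distrib]
  congr 1
  refine Finset.sum_congr rfl fun b _ => ?_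
  simp only [Pi.neg_apply]
  ring

variable {S Ω : Type*} [MeasurableSpace S] [MeasurableSpace Ω]
  {P : Measure Ω} {U : Ω → S} {η : ℕ → Ω → ℝ} {R : ℝ≥0}
  [IsProbabilityMeasure P] (hM : IsNoiseModel P U η R) (hR : R ≠ 0) (alg : Algorithm K S)

include hM hR

lemma IsNoiseModel.measure_hist_add (m δ : Fin K → ℝ) (t : ℕ)
    {A : Set (Fin t → Fin K × ℝ)} (hA : MeasurableSet A) :
    P {ω | hist alg U η (fun b => m b + δ b) t ω ∈ A}
      = ∫⁻ ω in {ω | hist alg U η m t ω ∈ A},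
          ENNReal.ofReal (Real.exp (logLik δ (R ^ 2 : ℝ) m (hist alg U η m t ω))) ∂P := by
  have hF : Measurable fun p : S × (Fin t → Fin K × ℝ) => A.indicator (fun _ => (1 : ℝ≥0∞)) p.2 :=
    (measurable_const.indicator hA).comp measurable_snd
  have h := hM.lintegral_hist_add alg hR m δ t hF
  have h1 : MeasurableSet {ω | hist alg U η m t ω ∈ A} := hM.measurable_hist alg m t hA
  have h2 : MeasurableSet {ω | hist alg U η (fun b => m b + δ b) t ω ∈ A} :=
    hM.measurable_hist alg _ t hA
  rw [← lintegral_indicator_one h2, ← lintegral_indicator h1]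
  refine Eq.trans h (lintegral_congr fun ω => ?_)
  by_cases hω : hist alg U η m t ω ∈ A <;> simp [Set.indicator, hω]

/-- Ville's inequality by a first-passage decomposition. On the event `D t` that level `u` is
reached for the first time at `t`, the likelihood ratio is at least `exp u`, so its probability is
at most `exp (-u)` times that under the means `m + δ`. The events `D t` are disjoint, so the latter
probabilities add up to at most `1`. -/
lemma IsNoiseModel.measure_exists_le_logLik (m δ : Fin K → ℝ) (u : ℝ) (T : ℕ) :
    P {ω | ∃ t ≤ T, u ≤ logLik δ (R ^ 2 : ℝ) m (hist alg U η m t ω)}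
      ≤ ENNReal.ofReal (Real.exp (-u)) := by
  let D : (t : ℕ) → Set (Fin t → Fin K × ℝ) := fun t =>
    {h | u ≤ logLik δ (R ^ 2 : ℝ) m h} ∩ ⋂ (r : ℕ) (hr : r < t),
      {h | logLik δ (R ^ 2 : ℝ) m (fun i => h (Fin.castLE hr.le i)) < u}
  have hD : ∀ t, MeasurableSet (D t) := fun t =>
    (measurableSet_le measurable_const (measurable_logLik _ _ _)).inter
      (MeasurableSet.iInter fun r => MeasurableSet.iInter fun hr =>
        measurableSet_lt ((measurable_logLik _ _ _).comp
          (measurable_pi_iff.2 fun i => measurable_pi_apply _)) measurable_const)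
  have hmem : ∀ (m' : Fin K → ℝ) (t : ℕ) (ω : Ω), hist alg U η m' t ω ∈ D t ↔
      u ≤ logLik δ (R ^ 2 : ℝ) m (hist alg U η m' t ω) ∧
        ∀ r < t, logLik δ (R ^ 2 : ℝ) m (hist alg U η m' r ω) < u := by
    intro m' t ω
    simp only [D, Set.mem_inter_iff, Set.mem_iInter, Set.mem_ofPred_eq]
    refine and_congr_right fun _ => forall₂_congr fun r hr => ?_
    rw [show hist alg U η m' r ω = _ from (history_prefix alg m' (U ω) _ hr.le).symm]
  set m' : Fin K → ℝ := fun b => m b + δ b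
  have hle : ∀ t, P {ω | hist alg U η m t ω ∈ D t}
      ≤ ENNReal.ofReal (Real.exp (-u)) * P {ω | hist alg U η m' t ω ∈ D t} := by
    intro t
    have h1 : MeasurableSet {ω | hist alg U η m t ω ∈ D t} := hM.measurable_hist alg m t (hD t)
    rw [hM.measure_hist_add hR alg m δ t (hD t)]
    have h2 : ∫⁻ ω in {ω | hist alg U η m t ω ∈ D t}, ENNReal.ofReal (Real.exp u) ∂P
        ≤ ∫⁻ ω in {ω | hist alg U η m t ω ∈ D t},
          ENNReal.ofReal (Real.exp (logLik δ (R ^ 2 : ℝ) m (hist alg U η m t ω))) ∂P :=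
      setLIntegral_mono' h1 fun ω hω => ENNReal.ofReal_le_ofReal
        (Real.exp_le_exp.2 ((hmem m t ω).1 hω).1)
    rw [setLIntegral_const] at h2
    calc P {ω | hist alg U η m t ω ∈ D t}
        = ENNReal.ofReal (Real.exp (-u)) * (ENNReal.ofReal (Real.exp u)
          * P {ω | hist alg U η m t ω ∈ D t}) := by
          rw [← mul_assoc, ← ENNReal.ofReal_mul (Real.exp_pos _).le, ← Real.exp_add]
          simp
      _ ≤ _ := by gcongr
  have hsub : {ω | ∃ t ≤ T, u ≤ logLik δ (R ^ 2 : ℝ) m (hist alg U η m t ω)}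
      ⊆ ⋃ t ∈ Finset.range (T + 1), {ω | hist alg U η m t ω ∈ D t} := by
    classical
    rintro ω ⟨t, htT, ht⟩
    have hex : ∃ t, u ≤ logLik δ (R ^ 2 : ℝ) m (hist alg U η m t ω) := ⟨t, ht⟩
    simp only [Set.mem_iUnion, Finset.mem_range, Set.mem_ofPred_eq]
    refine ⟨Nat.find hex, ?_, (hmem m _ ω).2 ⟨Nat.find_spec hex, fun r hr => ?_⟩⟩
    · exact Nat.lt_succ_of_le ((Nat.find_min' hex ht).trans htT)
    · exact not_le.1 (Nat.find_min hex hr)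
  have hdisj : Set.PairwiseDisjoint (↑(Finset.range (T + 1)))
      fun t => {ω | hist alg U η m' t ω ∈ D t} := by
    have key : ∀ t r ω, r < t → hist alg U η m' t ω ∈ D t → hist alg U η m' r ω ∈ D r → False :=
      fun t r ω hrt ht hr =>
        absurd ((hmem m' r ω).1 hr).1 (not_le.2 (((hmem m' t ω).1 ht).2 r hrt))
    intro t _ r _ htr
    refine Set.disjoint_left.2 fun ω ht hr => ?_
    rcases lt_or_gt_of_ne htr with h | h
    · exact key r t ω h hr ht
    · exact key t r ω h ht hr
  calc P {ω | ∃ t ≤ T, u ≤ logLik δ (R ^ 2 : ℝ) m (hist alg U η m t ω)}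
      ≤ P (⋃ t ∈ Finset.range (T + 1), {ω | hist alg U η m t ω ∈ D t}) := measure_mono hsub
    _ ≤ ∑ t ∈ Finset.range (T + 1), P {ω | hist alg U η m t ω ∈ D t} :=
        measure_biUnion_finset_le _ _
    _ ≤ ∑ t ∈ Finset.range (T + 1),
          ENNReal.ofReal (Real.exp (-u)) * P {ω | hist alg U η m' t ω ∈ D t} :=
        Finset.sum_le_sum fun t _ => hle t
    _ = ENNReal.ofReal (Real.exp (-u))
          * P (⋃ t ∈ Finset.range (T + 1), {ω | hist alg U η m' t ω ∈ D t}) := by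
        rw [measure_biUnion_finset hdisj fun t _ => hM.measurable_hist alg m' t (hD t),
          Finset.mul_sum]
    _ ≤ ENNReal.ofReal (Real.exp (-u)) * 1 := by gcongr; exact prob_le_one
    _ = _ := mul_one _

/-- With high probability, at all times up to `T`, the noise accumulated by every arm is of the
order of the square root of its number of pulls. -/
lemma IsNoiseModel.measure_exists_lt_noise_sq (m : Fin K → ℝ) {β : ℝ} (hβ : 0 < β) (T : ℕ) :
    P {ω | ∃ t ≤ T, ∃ b, β * pulls (hist alg U η m t ω) b < noise m (hist alg U η m t ω) b ^ 2}
      ≤ ENNReal.ofReal ((Nat.log 2 T + 1) * (K * (2 * Real.exp (-(β / (4 * R ^ 2)))))) := by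
  -- Peeling over dyadic pull counts `n`: to detect a deviation `√(β * n)` the best tilt is `√(β /
  -- n)`, and one tilt per block `2 ^ k ≤ n ≤ 2 ^ (k + 1)` loses only a constant. The signs `1` and
  -- `-1` in `B` cover both tails.
  set e : ℕ → ℝ := fun k => √(β / 2 ^ (k + 1))
  set B : ℕ → Fin K → ℝ → Set Ω := fun k b s => {ω | ∃ t ≤ T, β / (4 * R ^ 2)
    ≤ logLik (Pi.single b (s * e k)) (R ^ 2 : ℝ) m (hist alg U η m t ω)}
  have hR2 : (0 : ℝ) < R ^ 2 := by positivity
  have hsub : {ω | ∃ t ≤ T, ∃ b,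
        β * pulls (hist alg U η m t ω) b < noise m (hist alg U η m t ω) b ^ 2}
      ⊆ ⋃ k ∈ Finset.range (Nat.log 2 T + 1), ⋃ b ∈ (Finset.univ : Finset (Fin K)),
        (B k b 1 ∪ B k b (-1)) := by
    rintro ω ⟨t, htT, b, hb⟩
    set h := hist alg U η m t ω
    obtain ⟨n, hn⟩ := pulls_eq_natCast h b
    have hn0 : n ≠ 0 := by
      rintro rfl
      rw [noise_eq_zero m h b (by simpa using hn), hn] at hb
      simp at hb
    have hnT : n ≤ T := by
      have := pulls_le h b
      rw [hn] at this
      exact (Nat.cast_le.1 this).trans htT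
    set k := Nat.log 2 n
    have hk1 : (2 : ℝ) ^ k ≤ n := by exact_mod_cast Nat.pow_log_le_self 2 hn0
    have hk2 : (n : ℝ) ≤ 2 ^ (k + 1) := by
      exact_mod_cast (Nat.lt_pow_succ_log_self one_lt_two n).le
    have he2 : e k ^ 2 = β / 2 ^ (k + 1) := Real.sq_sqrt (by positivity)
    have he0 : 0 ≤ e k := Real.sqrt_nonneg _
    have hp : (0 : ℝ) < 2 ^ (k + 1) := by positivity
    have hw1 : β / 2 ≤ e k ^ 2 * n := by
      rw [he2, div_mul_eq_mul_div, le_div_iff₀ hp, pow_succ]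
      nlinarith
    have hw2 : e k ^ 2 * n ≤ β := by
      rw [he2, div_mul_eq_mul_div, div_le_iff₀ hp]
      gcongr
    -- Up to the factor `R ^ 2`, the right side is the log-likelihood ratio for this tilt, taken
    -- with the favourable sign.
    have hy : β / 4 ≤ e k * |noise m h b| - e k ^ 2 * n / 2 := by
      refine quarter_add_half_le hw1 hw2 (by positivity) ?_
      rw [mul_pow, sq_abs]
      rw [hn] at hb
      nlinarith [mul_le_mul_of_nonneg_left hb.le (sq_nonneg (e k))]
    simp only [Set.mem_iUnion, Finset.mem_range, Finset.mem_univ, exists_prop, true_and]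
    refine ⟨k, Nat.lt_succ_of_le (Nat.log_mono_right hnT), b, ?_⟩
    have hfin : ∀ s : ℝ, s ^ 2 = 1 → s * noise m h b = |noise m h b| → ω ∈ B k b s := by
      intro s hs hs'
      refine ⟨t, htT, ?_⟩
      rw [logLik_single, hn, ← div_div, div_le_div_iff_of_pos_right hR2, mul_pow, hs]
      have : s * e k * noise m h b = e k * |noise m h b| := by rw [← hs']; ring
      rw [this]
      linarith
    rcases le_total 0 (noise m h b) with h0 | h0
    · exact Or.inl (hfin 1 (by norm_num) (by rw [abs_of_nonneg h0, one_mul]))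
    · exact Or.inr (hfin (-1) (by norm_num) (by rw [abs_of_nonpos h0, neg_one_mul]))
  set q := ENNReal.ofReal (Real.exp (-(β / (4 * R ^ 2))))
  have hB : ∀ k b s, P (B k b s) ≤ q := fun k b s =>
    hM.measure_exists_le_logLik hR alg m _ _ T
  calc _ ≤ _ := measure_mono hsub
    _ ≤ ∑ k ∈ Finset.range (Nat.log 2 T + 1), ∑ b : Fin K, (q + q) := by
        refine (measure_biUnion_finset_le _ _).trans (Finset.sum_le_sum fun k _ => ?_)
        refine (measure_biUnion_finset_le _ _).trans (Finset.sum_le_sum fun b _ => ?_)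
        exact (measure_union_le _ _).trans (add_le_add (hB _ _ _) (hB _ _ _))
    _ = _ := by
        simp only [Finset.sum_const, Finset.card_range, Finset.card_univ, Fintype.card_fin,
          nsmul_eq_mul]
        rw [ENNReal.ofReal_mul (by positivity), ENNReal.ofReal_mul (by positivity),
          ENNReal.ofReal_mul (by positivity)]
        rw [← two_mul]
        norm_cast

/-- With `l` and `W` the log-likelihood ratio and the information, the ratio for `-δ` is `exp (-l -
W)`. By the inequality of arithmetic and geometric means, `exp v * exp l + exp (-l - W) / 4 ≥ exp
((v - W) / 2) ≥ 1` on the event. Integrating, the first term gives the probability under `m + δ`,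
while the second is at most a quarter of the total mass under `m - δ`. No concentration bound for
`l` is needed. -/
lemma IsNoiseModel.measure_hist_le_add (m δ : Fin K → ℝ) (t : ℕ) (v : ℝ)
    {A : Set (Fin t → Fin K × ℝ)} (hA : MeasurableSet A) :
    P {ω | hist alg U η m t ω ∈ A ∧
        (∑ b, δ b ^ 2 * pulls (hist alg U η m t ω) b) / (R ^ 2 : ℝ) ≤ v}
      ≤ ENNReal.ofReal (Real.exp v) * P {ω | hist alg U η (fun b => m b + δ b) t ω ∈ A}
        + ENNReal.ofReal (1 / 4) := by
  have h1 : MeasurableSet {ω | hist alg U η m t ω ∈ A} := hM.measurable_hist alg m t hA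
  have hV : Measurable fun ω => (∑ b, δ b ^ 2 * pulls (hist alg U η m t ω) b) / (R ^ 2 : ℝ) :=
    (Finset.measurable_sum _ fun b _ =>
      ((measurable_pulls b).comp (hM.measurable_hist alg m t)).const_mul _).div_const _
  set E := {ω | hist alg U η m t ω ∈ A ∧
    (∑ b, δ b ^ 2 * pulls (hist alg U η m t ω) b) / (R ^ 2 : ℝ) ≤ v}
  have hE : MeasurableSet E := h1.inter (measurableSet_le hV measurable_const)
  have hl : ∀ δ, Measurable fun ω => ENNReal.ofReal
      (Real.exp (logLik δ (R ^ 2 : ℝ) m (hist alg U η m t ω))) := fun δ =>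
    ((measurable_logLik _ _ _).comp (hM.measurable_hist alg m t)).exp.ennreal_ofReal
  have h2 := hM.measure_hist_add hR alg m δ t hA
  have h3 := hM.measure_hist_add hR alg m (-δ) t MeasurableSet.univ
  simp only [Set.mem_univ, Set.ofPred_true, measure_univ, Measure.restrict_univ] at h3
  calc P E = ∫⁻ ω in E, 1 ∂P := by simp
    _ ≤ ∫⁻ ω in E, (ENNReal.ofReal (Real.exp v) * ENNReal.ofReal
          (Real.exp (logLik δ (R ^ 2 : ℝ) m (hist alg U η m t ω)))
        + ENNReal.ofReal (1 / 4) * ENNReal.ofReal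
          (Real.exp (logLik (-δ) (R ^ 2 : ℝ) m (hist alg U η m t ω)))) ∂P := by
        refine setLIntegral_mono' hE fun ω hω => ?_
        rw [← ENNReal.ofReal_mul (Real.exp_pos _).le, ← ENNReal.ofReal_mul (by norm_num),
          ← ENNReal.ofReal_add (by positivity) (by positivity), ← ENNReal.ofReal_one]
        refine ENNReal.ofReal_le_ofReal ?_
        rw [logLik_neg]
        set l := logLik δ (R ^ 2 : ℝ) m (hist alg U η m t ω)
        have hv := hω.2
        set W := (∑ b, δ b ^ 2 * pulls (hist alg U η m t ω) b) / (R ^ 2 : ℝ)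
        have e1 : Real.exp v * Real.exp l * Real.exp (-l - W) = Real.exp (v - W) := by
          rw [← Real.exp_add, ← Real.exp_add]
          congr 1
          ring
        have e2 : 1 ≤ Real.exp (v - W) := Real.one_le_exp (by linarith)
        refine le_of_sq_le_sq ?_ (by positivity)
        nlinarith [sq_nonneg (Real.exp v * Real.exp l - 1 / 4 * Real.exp (-l - W))]
    _ = ENNReal.ofReal (Real.exp v) * ∫⁻ ω in E, ENNReal.ofReal
          (Real.exp (logLik δ (R ^ 2 : ℝ) m (hist alg U η m t ω))) ∂P
        + ENNReal.ofReal (1 / 4) * ∫⁻ ω in E, ENNReal.ofReal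
          (Real.exp (logLik (-δ) (R ^ 2 : ℝ) m (hist alg U η m t ω))) ∂P := by
        rw [lintegral_add_left ((hl δ).const_mul _), lintegral_const_mul _ (hl δ),
          lintegral_const_mul _ (hl (-δ))]
    _ ≤ ENNReal.ofReal (Real.exp v) * P {ω | hist alg U η (fun b => m b + δ b) t ω ∈ A}
        + ENNReal.ofReal (1 / 4) * 1 := by
        rw [h2, h3]
        gcongr
        · exact fun ω hω => hω.1
        · exact Measure.restrict_le_self
    _ = _ := by rw [mul_one]

end

/-! ### The error of the ridge estimator. -/

section Ridge

variable {d K t : ℕ} (x : Fin K → Fin d → ℝ)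

lemma sum_history_eq_sum_pulls (h : Fin t → Fin K × ℝ) {M : Type*} [AddCommGroup M] [Module ℝ M]
    (f : Fin K → M) : ∑ i, f (h i).1 = ∑ b, pulls h b • f b := by
  simp only [pulls, Finset.sum_smul]
  rw [Finset.sum_comm]
  simp

lemma sum_rewards_eq (m : Fin K → ℝ) (h : Fin t → Fin K × ℝ) :
    ∑ i, (h i).2 • x (h i).1 = ∑ b, (m b * pulls h b + noise m h b) • x b := by
  have : ∀ i, (h i).2 • x (h i).1
      = ∑ b, (m b * (if (h i).1 = b then 1 else 0)
        + if (h i).1 = b then (h i).2 - m b else 0) • x b := by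
    intro i
    rw [Finset.sum_eq_single (h i).1]
    · simp
    · intro b _ hb
      simp [hb.symm]
    · simp
  rw [Finset.sum_congr rfl fun i _ => this i, Finset.sum_comm]
  refine Finset.sum_congr rfl fun b _ => ?_
  rw [← Finset.sum_smul, Finset.sum_add_distrib, ← Finset.mul_sum]
  rfl

lemma gram_mulVec (lam : ℝ) (h : Fin t → Fin K × ℝ) (w : Fin d → ℝ) :
    gram x lam h *ᵥ w = lam • w + ∑ b, (pulls h b * (x b ⬝ᵥ w)) • x b := by
  rw [gram, Matrix.add_mulVec, Matrix.smul_mulVec, Matrix.one_mulVec, Matrix.sum_mulVec]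
  congr 1
  rw [sum_history_eq_sum_pulls h fun b => Matrix.vecMulVec (x b) (x b) *ᵥ w]
  refine Finset.sum_congr rfl fun b _ => ?_
  rw [Matrix.vecMulVec_mulVec, mul_smul]
  simp

lemma dotProduct_gram_mulVec (lam : ℝ) (h : Fin t → Fin K × ℝ) (w : Fin d → ℝ) :
    w ⬝ᵥ (gram x lam h *ᵥ w) = lam * (w ⬝ᵥ w) + ∑ b, pulls h b * (x b ⬝ᵥ w) ^ 2 := by
  rw [gram_mulVec, dotProduct_add, dotProduct_smul, dotProduct_sum, smul_eq_mul]
  congr 1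
  refine Finset.sum_congr rfl fun b _ => ?_
  rw [dotProduct_smul, dotProduct_comm w, smul_eq_mul]
  ring

lemma isUnit_gram {lam : ℝ} (hlam : 0 < lam) (h : Fin t → Fin K × ℝ) :
    IsUnit (gram x lam h) := by
  rw [← Matrix.mulVec_injective_iff_isUnit]
  intro u w huw
  have h0 : gram x lam h *ᵥ (u - w) = 0 := by
    rw [Matrix.mulVec_sub]
    exact sub_eq_zero.2 huw
  have h1 := dotProduct_gram_mulVec x lam h (u - w)
  rw [h0, dotProduct_zero] at h1
  have h2 : 0 ≤ ∑ b, pulls h b * (x b ⬝ᵥ (u - w)) ^ 2 :=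
    Finset.sum_nonneg fun b _ => mul_nonneg (pulls_nonneg h b) (sq_nonneg _)
  have h3 : 0 ≤ (u - w) ⬝ᵥ (u - w) := Finset.sum_nonneg fun i _ => mul_self_nonneg _
  have h4 : (u - w) ⬝ᵥ (u - w) = 0 := by nlinarith
  exact sub_eq_zero.1 (dotProduct_self_eq_zero.1 h4)

lemma gram_mulVec_ridge {lam : ℝ} (hlam : 0 < lam) (h : Fin t → Fin K × ℝ) :
    gram x lam h *ᵥ ridge x lam h = ∑ i, (h i).2 • x (h i).1 := by
  rw [ridge, Matrix.mulVec_mulVec, Matrix.mul_nonsing_inv _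
    ((Matrix.isUnit_iff_isUnit_det _).1 (isUnit_gram x hlam h)), Matrix.one_mulVec]

lemma mul_le_half_add {S e N β : ℝ} (hβ : 0 ≤ β) (hN : 0 ≤ N) (h : S ^ 2 ≤ β * N) :
    S * e ≤ (β + N * e ^ 2) / 2 := by
  refine le_of_sq_le_sq ?_ (by positivity)
  nlinarith [sq_nonneg (β - N * e ^ 2), mul_le_mul_of_nonneg_right h (sq_nonneg e)]

/-- The prediction error of the ridge estimator for an arm is controlled by the number of pulls of
that arm, as soon as the noise accumulated by every arm is. -/
lemma pulls_mul_sq_estReward_sub_le (θ : Fin d → ℝ) {lam : ℝ} (hlam : 0 < lam) {β : ℝ}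
    (hβ : 0 ≤ β) (h : Fin t → Fin K × ℝ)
    (hn : ∀ b, noise (meanReward x θ) h b ^ 2 ≤ β * pulls h b) (a : Fin K) :
    pulls h a * (estReward x lam h a - meanReward x θ a) ^ 2 ≤ K * β + lam * (θ ⬝ᵥ θ) := by
  set w := ridge x lam h - θ with hw
  have he : ∀ b, estReward x lam h b - meanReward x θ b = x b ⬝ᵥ w := by
    intro b
    rw [hw, dotProduct_sub]
    rfl
  have hgw : gram x lam h *ᵥ w = ∑ b, noise (meanReward x θ) h b • x b - lam • θ := by
    rw [hw, Matrix.mulVec_sub, gram_mulVec_ridge x hlam, gram_mulVec,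
      sum_rewards_eq x (meanReward x θ), sub_add_eq_sub_sub_swap, ← Finset.sum_sub_distrib]
    congr 1
    refine Finset.sum_congr rfl fun b _ => ?_
    rw [← sub_smul, meanReward]
    congr 1
    ring
  have h1 := dotProduct_gram_mulVec x lam h w
  rw [hgw, dotProduct_sub, dotProduct_sum, dotProduct_smul, smul_eq_mul] at h1
  have h2 : ∑ b, w ⬝ᵥ (noise (meanReward x θ) h b • x b)
      ≤ ∑ b, (β + pulls h b * (x b ⬝ᵥ w) ^ 2) / 2 := by
    refine Finset.sum_le_sum fun b _ => ?_
    rw [dotProduct_smul, dotProduct_comm, smul_eq_mul]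
    exact mul_le_half_add hβ (pulls_nonneg h b) (hn b)
  rw [← Finset.sum_div, Finset.sum_add_distrib] at h2
  simp only [Finset.sum_const, Finset.card_univ, Fintype.card_fin, nsmul_eq_mul] at h2
  -- The bias enters through the cross term `-lam * (w ⬝ᵥ θ)`, which this square bounds in terms of
  -- `w ⬝ᵥ w` and `θ ⬝ᵥ θ`.
  have h3 : 0 ≤ (w + θ) ⬝ᵥ (w + θ) := Finset.sum_nonneg fun i _ => mul_self_nonneg _
  rw [dotProduct_add, add_dotProduct, add_dotProduct, dotProduct_comm θ w] at h3
  have h4 : pulls h a * (x a ⬝ᵥ w) ^ 2 ≤ ∑ b, pulls h b * (x b ⬝ᵥ w) ^ 2 :=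
    Finset.single_le_sum (f := fun b => pulls h b * (x b ⬝ᵥ w) ^ 2)
      (fun b _ => mul_nonneg (pulls_nonneg h b) (sq_nonneg _)) (Finset.mem_univ a)
  have h5 : 0 ≤ w ⬝ᵥ w := Finset.sum_nonneg fun i _ => mul_self_nonneg _
  rw [he]
  linarith [mul_nonneg hlam.le h3, mul_nonneg hlam.le h5]

end Ridge

/-! ### Gaps, and the pathwise lower bound on the compensation. -/

section Gap

lemma exists_forall_le_of_pos {ι : Type*} [Finite ι] (f : ι → ℝ) :
    ∃ D > 0, ∀ b, 0 < f b → D ≤ f b := by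
  classical
  cases nonempty_fintype ι
  by_cases h : ∃ b, 0 < f b
  · obtain ⟨b, hb, hmin⟩ := Finset.exists_min_image
      (Finset.univ.filter fun b => 0 < f b) f (h.imp fun b hb => by simpa using hb)
    exact ⟨f b, by simpa using hb, fun c hc => hmin c (by simpa using hc)⟩
  · exact ⟨1, one_pos, fun b hb => absurd ⟨b, hb⟩ h⟩

variable {d K : ℕ} (x : Fin K → Fin d → ℝ) (θ : Fin d → ℝ)

lemma meanReward_le_iSup (a : Fin K) : meanReward x θ a ≤ ⨆ b, meanReward x θ b :=
  le_ciSup (Set.finite_range _).bddAbove a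

lemma gap_nonneg (a : Fin K) : 0 ≤ gap x θ a :=
  sub_nonneg.2 (meanReward_le_iSup x θ a)

lemma exists_forall_gap_le : ∃ M, 0 ≤ M ∧ ∀ b, gap x θ b ≤ M :=
  ⟨∑ b, gap x θ b, Finset.sum_nonneg fun b _ => gap_nonneg x θ b, fun b =>
    Finset.single_le_sum (fun b _ => gap_nonneg x θ b) (Finset.mem_univ b)⟩

end Gap

section Path

variable {d K : ℕ} {S : Type*} [MeasurableSpace S] (x : Fin K → Fin d → ℝ) (θ : Fin d → ℝ)
  (alg : Algorithm K S) (s : S) (z : ℕ → ℝ)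

/-- Each counted round raises the potential `∑ b, min N_b (q + 1)` by one, and the potential never
exceeds `K * (q + 1)`. -/
lemma sum_pulls_le_le (m : Fin K → ℝ) {q : ℝ} (hq : 0 ≤ q) (T : ℕ) :
    ∑ t ∈ Finset.range T,
      (if pulls (history alg m s z t) (arm alg m s z t) ≤ q then (1 : ℝ) else 0)
      ≤ K * (q + 1) := by
  have h : ∑ t ∈ Finset.range T,
      (if pulls (history alg m s z t) (arm alg m s z t) ≤ q then (1 : ℝ) else 0)
      ≤ ∑ b, min (pulls (history alg m s z T) b) (q + 1) := by
    induction T with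
    | zero =>
      simp only [Finset.range_zero, Finset.sum_empty]
      exact Finset.sum_nonneg fun b _ => le_min (pulls_nonneg _ _) (by linarith)
    | succ T ih =>
      rw [Finset.sum_range_succ]
      have h1 : ∑ b, min (pulls (history alg m s z T) b) (q + 1)
          + ∑ b, (if arm alg m s z T = b then
              (if pulls (history alg m s z T) b ≤ q then (1 : ℝ) else 0) else 0)
          ≤ ∑ b, min (pulls (history alg m s z (T + 1)) b) (q + 1) := by
        rw [← Finset.sum_add_distrib]
        refine Finset.sum_le_sum fun b _ => ?_
        rw [pulls_history_succ]
        split_ifs with h1 h2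
        · rw [min_eq_left (by linarith), min_eq_left (by linarith)]
        · rw [add_zero]
          exact min_le_min (by linarith) le_rfl
        · simp
      rw [Finset.sum_ite_eq, if_pos (Finset.mem_univ _)] at h1
      linarith
  refine h.trans ((Finset.sum_le_sum fun b _ => min_le_right _ _).trans_eq ?_)
  rw [Finset.sum_const, Finset.card_univ, Fintype.card_fin, nsmul_eq_mul]

/-- Pathwise lower bound: up to a bounded number of rounds, every pull of a suboptimal arm costs at
least a third of its gap. -/
lemma le_sum_compensation {lam : ℝ} (hlam : 0 < lam) {β D M q : ℝ} (hβ : 0 ≤ β) (hD : 0 < D)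
    (hDg : ∀ b, 0 < gap x θ b → D ≤ gap x θ b) (hMg : ∀ b, gap x θ b ≤ M)
    (hq : 9 * (K * β + lam * (θ ⬝ᵥ θ)) ≤ q * D ^ 2) (hq0 : 0 ≤ q) {T T₁ : ℕ} (hqT : 2 * (K * q) < T₁)
    (hsub : 2 * ∑ b with 0 < gap x θ b, pulls (history alg (meanReward x θ) s z T₁) b ≤ T₁)
    (hn : ∀ t ≤ T, ∀ b, noise (meanReward x θ) (history alg (meanReward x θ) s z t) b ^ 2
      ≤ β * pulls (history alg (meanReward x θ) s z t) b)
    {c : ℕ → ℝ} (hc : ∀ t, 0 ≤ c t)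
    (hce : ∀ t i, estReward x lam (history alg (meanReward x θ) s z t) i
      - estReward x lam (history alg (meanReward x θ) s z t) (arm alg (meanReward x θ) s z t)
      ≤ c t) :
    ∑ b, gap x θ b / 3 * pulls (history alg (meanReward x θ) s z T) b
        - M / 3 * (T₁ + K * (q + 1))
      ≤ ∑ t ∈ Finset.range T, c t := by
  set m := meanReward x θ
  have hM : 0 ≤ M := (gap_nonneg x θ (arm alg m s z 0)).trans (hMg _)
  -- More than `q` pulls make the estimate accurate to `D / 3`; this is what the factor `9` in `hq`
  -- is for.
  have hsmall : ∀ t ≤ T, ∀ b, q < pulls (history alg m s z t) b →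
      (estReward x lam (history alg m s z t) b - m b) ^ 2 < (D / 3) ^ 2 := by
    intro t ht b hb
    have h1 := pulls_mul_sq_estReward_sub_le x θ hlam hβ _ (hn t ht) b
    by_contra hcon
    rw [not_lt] at hcon
    have h2 : q * (D / 3) ^ 2 < pulls (history alg m s z t) b
        * (estReward x lam (history alg m s z t) b - m b) ^ 2 := by
      have : 0 < (D / 3) ^ 2 := by positivity
      nlinarith
    nlinarith
  have hstep : ∀ t < T, gap x θ (arm alg m s z t) / 3
      - M / 3 * ((if t < T₁ then 1 else 0)
        + if pulls (history alg m s z t) (arm alg m s z t) ≤ q then 1 else 0) ≤ c t := by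
    intro t ht
    set a := arm alg m s z t
    have hga := hMg a
    by_cases h1 : t < T₁
    · rw [if_pos h1]
      have h0 := hc t
      split_ifs <;> linarith
    by_cases h2 : pulls (history alg m s z t) a ≤ q
    · rw [if_pos h2, if_neg h1]
      linarith [hc t]
    rw [if_neg h1, if_neg h2]
    simp only [add_zero, mul_zero, sub_zero]
    rcases (gap_nonneg x θ a).eq_or_lt with h3 | h3
    · rw [← h3]
      simpa using hc t
    -- By pigeonhole: optimal arms received at least `T₁ / 2 > K * q` of the first `T₁` pulls.
    obtain ⟨o, ho, hoq⟩ : ∃ o, gap x θ o = 0 ∧ q < pulls (history alg m s z t) o := by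
      by_contra! hcon
      have h4 : ∑ b with ¬ 0 < gap x θ b, pulls (history alg m s z T₁) b ≤ K * q := by
        refine (Finset.sum_le_sum (g := fun _ => q) fun b hb => ?_).trans ?_
        · refine (pulls_history_mono alg m s z b (not_lt.1 h1)).trans (hcon b ?_)
          exact le_antisymm (not_lt.1 (Finset.mem_filter.1 hb).2) (gap_nonneg x θ b)
        · rw [Finset.sum_const, nsmul_eq_mul]
          gcongr
          exact_mod_cast (Finset.card_filter_le _ _).trans (by simp)
      have h5 := sum_pulls (history alg m s z T₁)
      rw [← Finset.sum_filter_add_sum_filter_not Finset.univ (fun b => 0 < gap x θ b)] at h5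
      linarith
    -- The true difference is `gap x θ a`, and each of the two errors is below `D / 3 ≤ gap x θ a /
    -- 3`, so a third of the gap survives in the estimates.
    have e1 := abs_lt_of_sq_lt_sq (hsmall t ht.le o hoq) (by positivity)
    have e2 := abs_lt_of_sq_lt_sq (hsmall t ht.le a (not_le.1 h2)) (by positivity)
    have e3 := hce t o
    have e4 : m o - m a = gap x θ a := by
      have : gap x θ o = (⨆ b, meanReward x θ b) - m o := rfl
      have : gap x θ a = (⨆ b, meanReward x θ b) - m a := rfl
      linarith
    have e5 := hDg a h3
    have e6 := (abs_lt.1 e1).1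
    have e7 := (abs_lt.1 e2).2
    linarith
  have hsum := Finset.sum_le_sum fun t ht => hstep t (Finset.mem_range.1 ht)
  rw [Finset.sum_sub_distrib, ← Finset.mul_sum, Finset.sum_add_distrib,
    sum_pulls_mul alg m s z fun b => gap x θ b / 3] at hsum
  have hT1 : ∑ t ∈ Finset.range T, (if t < T₁ then (1 : ℝ) else 0) ≤ T₁ := by
    rw [← Finset.sum_filter, Finset.sum_const, nsmul_eq_mul, mul_one]
    have : (Finset.range T).filter (· < T₁) ⊆ Finset.range T₁ := by
      intro i hi
      simpa using (Finset.mem_filter.1 hi).2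
    exact_mod_cast (Finset.card_le_card this).trans (by simp)
  have hT2 := sum_pulls_le_le alg s z m hq0 T
  refine le_trans ?_ hsum
  gcongr

end Path

/-! ### Regret in terms of pulls, and the good event. -/

lemma tendsto_log_add_one_mul_exp {c : ℝ} (hc : 0 < c) (k : ℝ) :
    Tendsto (fun T : ℕ => ((Nat.log 2 T : ℝ) + 1) * (k * (2 * Real.exp (-(c * Real.log T)))))
      atTop (nhds 0) := by
  have h1 : Tendsto (fun T : ℕ => Real.log T) atTop atTop :=
    Real.tendsto_log_atTop.comp tendsto_natCast_atTop_atTop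
  have h2 : Tendsto (fun y : ℝ => (y / Real.log 2 + 1) * (|k| * (2 * Real.exp (-(c * y)))))
      atTop (nhds 0) := by
    have e1 : Tendsto (fun y : ℝ => y * Real.exp (-(c * y))) atTop (nhds 0) := by
      have := tendsto_rpow_mul_exp_neg_mul_atTop_nhds_zero 1 c hc
      simpa using this
    have e0 : Tendsto (fun y : ℝ => Real.exp (-(c * y))) atTop (nhds 0) :=
      Real.tendsto_exp_neg_atTop_nhds_zero.comp (tendsto_id.const_mul_atTop hc)
    have := ((e1.const_mul (1 / Real.log 2)).add e0).const_mul (|k| * 2)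
    simp only [mul_zero, add_zero] at this
    refine this.congr fun y => ?_
    ring
  refine squeeze_zero_norm' ?_ (h2.comp h1)
  filter_upwards [eventually_ge_atTop 1] with T hT
  rw [Real.norm_eq_abs, abs_mul, abs_mul, abs_of_nonneg (by positivity : (0:ℝ) ≤ Nat.log 2 T + 1),
    abs_of_nonneg (by positivity : (0:ℝ) ≤ 2 * Real.exp (-(c * Real.log T)))]
  simp only [Function.comp_apply]
  gcongr
  rw [le_div_iff₀ (Real.log_pos one_lt_two), ← Real.log_pow]
  refine Real.log_le_log (by positivity) ?_
  exact_mod_cast Nat.pow_log_le_self 2 (by omega)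

section

variable {d K : ℕ} {S Ω : Type*} [MeasurableSpace S] [MeasurableSpace Ω]
  {P : Measure Ω} {U : Ω → S} {η : ℕ → Ω → ℝ} {R : ℝ≥0}
  (hM : IsNoiseModel P U η R) (alg : Algorithm K S)

include hM

lemma IsNoiseModel.measurable_pulls_hist (m : Fin K → ℝ) (T : ℕ) (b : Fin K) :
    Measurable fun ω => pulls (hist alg U η m T ω) b :=
  (measurable_pulls b).comp (hM.measurable_hist alg m T)

lemma IsNoiseModel.integrable_pulls [IsProbabilityMeasure P] (m : Fin K → ℝ) (T : ℕ) (b : Fin K) :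
    Integrable (fun ω => pulls (hist alg U η m T ω) b) P := by
  refine Integrable.of_bound (hM.measurable_pulls_hist alg m T b).aestronglyMeasurable T
    (ae_of_all _ fun ω => ?_)
  rw [Real.norm_of_nonneg (pulls_nonneg _ _)]
  exact pulls_le _ _

variable (x : Fin K → Fin d → ℝ) (θ : Fin d → ℝ)

lemma IsNoiseModel.regret_eq [IsProbabilityMeasure P] (T : ℕ) :
    regret x alg P U η θ T
      = ∑ b, gap x θ b * ∫ ω, pulls (hist alg U η (meanReward x θ) T ω) b ∂P := by
  have hint : ∀ (f : Fin K → ℝ) (t : ℕ),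
      Integrable (fun ω => f (arm alg (meanReward x θ) (U ω) (fun i => η i ω) t)) P := by
    intro f t
    refine Integrable.of_bound ((measurable_of_countable f).comp
      (hM.measurable_arm alg _ t)).aestronglyMeasurable (∑ b, |f b|) (ae_of_all _ fun ω => ?_)
    rw [Real.norm_eq_abs]
    exact Finset.single_le_sum (f := fun b => |f b|) (fun b _ => abs_nonneg _) (Finset.mem_univ _)
  have h1 : regret x alg P U η θ T = ∑ t ∈ Finset.range T,
      ∫ ω, gap x θ (arm alg (meanReward x θ) (U ω) (fun i => η i ω) t) ∂P := by
    refine Finset.sum_congr rfl fun t _ => ?_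
    simp only [gap]
    rw [integral_sub (integrable_const _) (hint _ t)]
    simp
  rw [h1, ← integral_finsetSum _ fun t _ => hint (gap x θ) t]
  simp only [sum_pulls_mul alg (meanReward x θ)]
  rw [integral_finsetSum _ fun b _ => (hM.integrable_pulls alg _ T b).const_mul _]
  refine Finset.sum_congr rfl fun b _ => ?_
  rw [integral_const_mul]

/-- The event that the noise is under control up to round `T`, and that the suboptimal arms make
at most half of the first `T₁` rounds. -/
def goodEvent (U : Ω → S) (η : ℕ → Ω → ℝ) (β : ℝ) (T T₁ : ℕ) : Set Ω :=
  {ω | ∀ t ≤ T, ∀ b, noise (meanReward x θ) (hist alg U η (meanReward x θ) t ω) b ^ 2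
      ≤ β * pulls (hist alg U η (meanReward x θ) t ω) b}
    ∩ {ω | 2 * ∑ b with 0 < gap x θ b, pulls (hist alg U η (meanReward x θ) T₁ ω) b ≤ T₁}

lemma IsNoiseModel.measurableSet_goodEvent (β : ℝ) (T T₁ : ℕ) :
    MeasurableSet (goodEvent alg x θ U η β T T₁) := by
  refine MeasurableSet.inter ?_ (measurableSet_le ((Finset.measurable_sum _ fun b _ =>
    hM.measurable_pulls_hist alg _ T₁ b).const_mul _) measurable_const)
  have : {ω | ∀ t ≤ T, ∀ b, noise (meanReward x θ) (hist alg U η (meanReward x θ) t ω) b ^ 2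
      ≤ β * pulls (hist alg U η (meanReward x θ) t ω) b}
      = ⋂ (t : ℕ) (_ : t ≤ T) (b : Fin K),
        {ω | noise (meanReward x θ) (hist alg U η (meanReward x θ) t ω) b ^ 2
          ≤ β * pulls (hist alg U η (meanReward x θ) t ω) b} := by
    ext ω
    simp
  rw [this]
  refine MeasurableSet.iInter fun t => MeasurableSet.iInter fun _ => MeasurableSet.iInter fun b =>
    measurableSet_le ?_ ((hM.measurable_pulls_hist alg (meanReward x θ) t b).const_mul β)
  exact ((IncentivizedBandit.measurable_noise (meanReward x θ) b).comp
    (hM.measurable_hist alg (meanReward x θ) t)).pow_const 2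

/-- The noise fails with probability of order `log T` times a negative power of `T`. The pulls in
the first `T₁` rounds are handled by Markov's inequality and the sublinear regret at horizon `T₁`,
which tends to infinity with `T`. -/
lemma IsNoiseModel.tendsto_goodEvent_compl [IsProbabilityMeasure P] (hR : R ≠ 0) (hcons : IsConsistent x alg P U η)
    {ε₁ ε₂ : ℝ} (h1 : 0 < ε₁) (h2 : 0 < ε₂) :
    Tendsto (fun T : ℕ => P.real
      (goodEvent alg x θ U η (ε₁ * Real.log T) T ⌊ε₂ * Real.log T⌋₊)ᶜ) atTop (nhds 0) := by
  have hR0 : (0 : ℝ) < R := by positivity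
  have hlog : Tendsto (fun T : ℕ => Real.log T) atTop atTop :=
    Real.tendsto_log_atTop.comp tendsto_natCast_atTop_atTop
  have hT1 : Tendsto (fun T : ℕ => ⌊ε₂ * Real.log T⌋₊) atTop atTop :=
    tendsto_nat_floor_atTop.comp (hlog.const_mul_atTop h2)
  obtain ⟨D, hD, hDg⟩ := exists_forall_le_of_pos (gap x θ)
  have ha := tendsto_log_add_one_mul_exp (c := ε₁ / (4 * R ^ 2)) (by positivity) K
  have hb : Tendsto (fun T : ℕ => 2 / D * (regret x alg P U η θ T / T)) atTop (nhds 0) := by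
    have := (hcons θ 1 one_pos le_rfl).tendsto_div_nhds_zero.const_mul (2 / D)
    simpa using this
  have hab := ha.add (hb.comp hT1)
  rw [add_zero] at hab
  refine squeeze_zero' (Eventually.of_forall fun T => measureReal_nonneg) ?_ hab
  filter_upwards [hlog.eventually_gt_atTop 0, hT1.eventually_gt_atTop 0] with T hT hT1
  set T₁ := ⌊ε₂ * Real.log T⌋₊
  set m := meanReward x θ with hm
  have hT1' : (0 : ℝ) < T₁ := by exact_mod_cast hT1
  rw [goodEvent, Set.compl_inter]
  refine (measureReal_union_le _ _).trans (add_le_add ?_ ?_)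
  · have := hM.measure_exists_lt_noise_sq hR alg m (β := ε₁ * Real.log T) (by positivity) T
    have h3 := ENNReal.toReal_mono ENNReal.ofReal_ne_top this
    rw [ENNReal.toReal_ofReal (by positivity)] at h3
    refine le_trans (le_of_eq ?_) (h3.trans (le_of_eq ?_))
    · rw [Measure.real]
      congr 2
      ext ω
      simp only [Set.mem_compl_iff, Set.mem_ofPred_eq]
      push Not
      rfl
    · congr 5
      ring
  · set f : Ω → ℝ := fun ω => 2 * ∑ b with 0 < gap x θ b, pulls (hist alg U η m T₁ ω) b
    have hfint : Integrable f P := (integrable_finsetSum _ fun b _ =>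
      hM.integrable_pulls alg m T₁ b).const_mul _
    have hmk := mul_meas_ge_le_integral_of_nonneg (μ := P) (f := f) (ae_of_all _ fun ω =>
      mul_nonneg two_pos.le (Finset.sum_nonneg fun b _ => pulls_nonneg _ _)) hfint T₁
    have hle : P.real {ω | f ω ≤ T₁}ᶜ ≤ P.real {ω | (T₁ : ℝ) ≤ f ω} :=
      measureReal_mono fun ω (hω : ¬ f ω ≤ T₁) => (not_le.1 hω).le
    have hint : ∫ ω, f ω ∂P ≤ 2 / D * regret x alg P U η θ T₁ := by
      rw [hM.regret_eq, integral_const_mul,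
        integral_finsetSum _ fun b _ => hM.integrable_pulls alg m T₁ b, div_mul_eq_mul_div,
        mul_div_assoc]
      gcongr
      rw [le_div_iff₀ hD, Finset.sum_mul]
      refine (Finset.sum_le_sum (g := fun b => gap x θ b * ∫ ω, pulls (hist alg U η m T₁ ω) b ∂P)
        fun b hb => ?_).trans (Finset.sum_le_sum_of_subset_of_nonneg (Finset.subset_univ _)
          fun b _ _ => mul_nonneg (gap_nonneg x θ b) (integral_nonneg fun ω => pulls_nonneg _ _))
      rw [mul_comm]
      exact mul_le_mul_of_nonneg_right (hDg b (Finset.mem_filter.1 hb).2)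
        (integral_nonneg fun ω => pulls_nonneg _ _)
    refine hle.trans ?_
    simp only [Function.comp_apply]
    rw [← mul_div_assoc, le_div_iff₀ hT1', mul_comm]
    exact hmk.trans hint

end

/-! ### The information inequality. -/

lemma measureReal_inter_le_of_setIntegral_le {Ω : Type*} [MeasurableSpace Ω] {P : Measure Ω}
    {f : Ω → ℝ} (hf0 : ∀ ω, 0 ≤ f ω) (hf : Integrable f P)
    {G : Set Ω} (hG : MeasurableSet G) {c r : ℝ} (hc : 0 < c) (h : ∫ ω in G, f ω ∂P ≤ r * c) :
    P.real (G ∩ {ω | c ≤ f ω}) ≤ r := by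
  have h1 := mul_meas_ge_le_integral_of_nonneg (μ := P.restrict G) (f := f)
    (ae_of_all _ hf0) hf.integrableOn c
  rw [measureReal_restrict_apply' hG, Set.inter_comm] at h1
  by_contra hcon
  rw [not_le] at hcon
  nlinarith

section

variable {d K : ℕ} {S Ω : Type*} [MeasurableSpace S] [MeasurableSpace Ω]
  {P : Measure Ω} {U : Ω → S} {η : ℕ → Ω → ℝ} {R : ℝ≥0}
  [IsProbabilityMeasure P] (hM : IsNoiseModel P U η R) (alg : Algorithm K S)
  (x : Fin K → Fin d → ℝ) (θ : Fin d → ℝ)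

/-- The shift raises arm `a` from `gap x θ a` below the optimum to the same amount above it, while
`b` stays at the old optimum. -/
lemma gap_add_ge {a b : Fin K} {u : Fin d → ℝ} (ha : x a ⬝ᵥ u = 2 * gap x θ a)
    (hb : gap x θ b = 0) (hbu : x b ⬝ᵥ u = 0) : gap x θ a ≤ gap x (θ + u) b := by
  have h1 := meanReward_le_iSup x (θ + u) a
  have h2 : ∀ c, meanReward x (θ + u) c = meanReward x θ c + x c ⬝ᵥ u := fun c =>
    dotProduct_add _ _ _
  unfold gap at *
  rw [h2] at h1 ⊢
  linarith

set_option maxHeartbeats 1000000 in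
include hM in
/-- The asymptotic information inequality: a consistent algorithm must collect enough information
to rule out every parameter that makes a suboptimal arm optimal without changing the means of the
optimal arms that it pulls often, even on events of large probability. -/
lemma IsNoiseModel.eventually_lt_information (hR : R ≠ 0) (hcons : IsConsistent x alg P U η)
    {G : ℕ → Set Ω} (hG : ∀ T, MeasurableSet (G T))
    (hGlim : Tendsto (fun T => P.real (G T)ᶜ) atTop (nhds 0))
    {a : Fin K} (hga : 0 < gap x θ a) {u : Fin d → ℝ} (ha : x a ⬝ᵥ u = 2 * gap x θ a) :
    ∀ᶠ T : ℕ in atTop, (R : ℝ) ^ 2 / 16 * Real.log T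
      < ∑ b, (x b ⬝ᵥ u) ^ 2
        * ∫ ω in G T, pulls (hist alg U η (meanReward x θ) T ω) b ∂P := by
  have hR2 : (0 : ℝ) < (R : ℝ) ^ 2 := by positivity
  set m := meanReward x θ with hm
  set δ : Fin K → ℝ := fun b => x b ⬝ᵥ u with hδ
  have hm' : meanReward x (θ + u) = fun b => m b + δ b := by
    funext b
    exact dotProduct_add _ _ _
  obtain ⟨D, hD, hDg⟩ := exists_forall_le_of_pos (gap x θ)
  obtain ⟨E, hE, hEg⟩ := exists_forall_le_of_pos (fun b => δ b ^ 2)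
  -- The optimal arms that the shift does not move. An arm outside `F` is either suboptimal, hence
  -- rarely pulled by sublinear regret, or moved, hence rarely pulled if the information is small.
  set F : Finset (Fin K) := Finset.univ.filter fun b => gap x θ b = 0 ∧ δ b = 0 with hF
  have hcast : Tendsto (fun T : ℕ => (T : ℝ)) atTop atTop := tendsto_natCast_atTop_atTop
  have hlogT : Tendsto (fun T : ℕ => Real.log T / T) atTop (nhds 0) :=
    (Real.isLittleO_log_id_atTop.tendsto_div_nhds_zero).comp hcast
  have hreg : Tendsto (fun T : ℕ => regret x alg P U η θ T / T) atTop (nhds 0) := by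
    simpa using (hcons θ 1 one_pos le_rfl).tendsto_div_nhds_zero
  have hr : Tendsto (fun T : ℕ => regret x alg P U η θ T / T / D
      + R ^ 2 / 16 / E * (Real.log T / T)) atTop (nhds 0) := by
    simpa using (hreg.div_const D).add (hlogT.const_mul (R ^ 2 / 16 / E))
  have hreg' := (hcons (θ + u) (1 / 2) (by norm_num) (by norm_num)).bound one_pos
  have hpow : Tendsto (fun T : ℕ => gap x θ a / 8 * (T : ℝ) ^ (1 / 4 : ℝ)) atTop atTop :=
    ((tendsto_rpow_atTop (by norm_num)).comp hcast).const_mul_atTop (by positivity)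
  filter_upwards [hr.eventually_lt_const (by norm_num : (0 : ℝ) < 1 / 16),
    hGlim.eventually_lt_const (by norm_num : (0 : ℝ) < 1 / 16), hreg',
    hpow.eventually_gt_atTop 1, eventually_gt_atTop 1] with T h1 h2 h3 h4 h5
  by_contra! hcon
  have hT : (1 : ℝ) < T := by exact_mod_cast h5
  have hT0 : (0 : ℝ) < T := by linarith
  have hlog : 0 < Real.log T := Real.log_pos hT
  set N : Fin K → Ω → ℝ := fun b ω => pulls (hist alg U η m T ω) b with hN
  have hN0 : ∀ b ω, 0 ≤ N b ω := fun b ω => pulls_nonneg _ _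
  have hNint : ∀ b, Integrable (N b) P := fun b => hM.integrable_pulls alg m T b
  set A : Set (Fin T → Fin K × ℝ) := {h | (T : ℝ) / 2 ≤ ∑ b ∈ F, pulls h b} with hA
  have hAm : MeasurableSet A :=
    measurableSet_le measurable_const (Finset.measurable_sum _ fun b _ => measurable_pulls b)
  -- the arms outside `F` are seldom pulled
  have e1 : P.real (G T ∩ {ω | (T : ℝ) / 2 ≤ ∑ b ∈ Fᶜ, N b ω}) ≤ 1 / 8 := by
    refine measureReal_inter_le_of_setIntegral_le
      (fun ω => Finset.sum_nonneg fun b _ => hN0 b ω)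
      (integrable_finsetSum _ fun b _ => hNint b) (hG T) (by positivity) ?_
    rw [integral_finsetSum _ fun b _ => (hNint b).integrableOn]
    have hb : ∀ b ∈ Fᶜ, ∫ ω in G T, N b ω ∂P
        ≤ gap x θ b * (∫ ω, N b ω ∂P) / D + δ b ^ 2 * (∫ ω in G T, N b ω ∂P) / E := by
      intro b hb
      have i1 : 0 ≤ ∫ ω in G T, N b ω ∂P := integral_nonneg fun ω => hN0 b ω
      have i2 : ∫ ω in G T, N b ω ∂P ≤ ∫ ω, N b ω ∂P :=
        setIntegral_le_integral (hNint b) (ae_of_all _ fun ω => hN0 b ω)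
      have i3 : 0 ≤ gap x θ b * (∫ ω, N b ω ∂P) / D :=
        div_nonneg (mul_nonneg (gap_nonneg x θ b) (i1.trans i2)) hD.le
      have i4 : 0 ≤ δ b ^ 2 * (∫ ω in G T, N b ω ∂P) / E := by positivity
      by_cases hgb : gap x θ b = 0
      · have hδb : δ b ≠ 0 := fun h => (Finset.mem_compl.1 hb) (by simp [hF, hgb, h])
        have : ∫ ω in G T, N b ω ∂P ≤ δ b ^ 2 * (∫ ω in G T, N b ω ∂P) / E := by
          rw [le_div_iff₀ hE, mul_comm]
          exact mul_le_mul_of_nonneg_right (hEg b (by positivity)) i1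
        linarith
      · have hgb' := (gap_nonneg x θ b).lt_of_ne' hgb
        have : ∫ ω, N b ω ∂P ≤ gap x θ b * (∫ ω, N b ω ∂P) / D := by
          rw [le_div_iff₀ hD, mul_comm]
          exact mul_le_mul_of_nonneg_right (hDg b hgb') (i1.trans i2)
        linarith
    have hsum : ∑ b ∈ Fᶜ, ∫ ω in G T, N b ω ∂P
        ≤ regret x alg P U η θ T / D + R ^ 2 / 16 * Real.log T / E := by
      refine (Finset.sum_le_sum hb).trans ((Finset.sum_le_sum_of_subset_of_nonneg
        (Finset.subset_univ _) fun b _ _ => add_nonneg ?_ ?_).trans ?_)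
      · exact div_nonneg (mul_nonneg (gap_nonneg x θ b) (integral_nonneg fun ω => hN0 b ω)) hD.le
      · exact div_nonneg (mul_nonneg (sq_nonneg _) (integral_nonneg fun ω => hN0 b ω)) hE.le
      · rw [Finset.sum_add_distrib, ← Finset.sum_div, ← Finset.sum_div, hM.regret_eq]
        gcongr
    refine hsum.trans ?_
    have : regret x alg P U η θ T / D + R ^ 2 / 16 * Real.log T / E
        = (regret x alg P U η θ T / T / D + R ^ 2 / 16 / E * (Real.log T / T)) * T := by
      field_simp
    rw [this]
    refine (mul_le_mul_of_nonneg_right h1.le hT0.le).trans (le_of_eq ?_)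
    ring
  -- the information collected is small
  set V : Ω → ℝ := fun ω => (∑ b, δ b ^ 2 * N b ω) / R ^ 2 with hV
  have e2 : P.real (G T ∩ {ω | Real.log T / 4 ≤ V ω}) ≤ 1 / 4 := by
    have i0 : ∀ ω, 0 ≤ V ω := fun ω =>
      div_nonneg (Finset.sum_nonneg fun b _ => mul_nonneg (sq_nonneg _) (hN0 b ω)) hR2.le
    have i1 : Integrable V P :=
      (integrable_finsetSum _ fun b _ => (hNint b).const_mul (δ b ^ 2)).div_const _
    have hlog4 : 0 < Real.log T / 4 := by linarith
    -- Markov's inequality: on `G T` the negated claim gives `V` integral at most `log T / 16`, a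
    -- quarter of the threshold.
    refine measureReal_inter_le_of_setIntegral_le i0 i1 (hG T) hlog4 ?_
    rw [hV, integral_div, integral_finsetSum _ fun b _ => ((hNint b).const_mul _).integrableOn,
      div_le_iff₀ hR2]
    simp only [integral_const_mul]
    linarith
  -- The exceptional events have total probability at most `1/16 + 1/8 + 1/4 < 1/2`.
  have e3 : 1 / 2 ≤ P.real {ω | hist alg U η m T ω ∈ A ∧ V ω ≤ Real.log T / 4} := by
    have hcov : (Set.univ : Set Ω) ⊆ {ω | hist alg U η m T ω ∈ A ∧ V ω ≤ Real.log T / 4}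
        ∪ ((G T)ᶜ ∪ ((G T ∩ {ω | (T : ℝ) / 2 ≤ ∑ b ∈ Fᶜ, N b ω})
          ∪ (G T ∩ {ω | Real.log T / 4 ≤ V ω}))) := by
      intro ω _
      by_cases hω : ω ∈ G T
      · by_cases hω1 : V ω ≤ Real.log T / 4
        · by_cases hω2 : hist alg U η m T ω ∈ A
          · exact Or.inl ⟨hω2, hω1⟩
          · refine Or.inr (Or.inr (Or.inl ⟨hω, ?_⟩))
            have h6 : ∑ b ∈ F, N b ω < T / 2 := not_le.1 hω2
            have h7 : ∑ b, N b ω = T := sum_pulls _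
            rw [← Finset.sum_add_sum_compl F] at h7
            change (T : ℝ) / 2 ≤ ∑ b ∈ Fᶜ, N b ω
            linarith
        · exact Or.inr (Or.inr (Or.inr ⟨hω, (not_le.1 hω1).le⟩))
      · exact Or.inr (Or.inl hω)
    have h6 := measureReal_mono (μ := P) hcov
    rw [probReal_univ] at h6
    have h7 := measureReal_union_le (μ := P)
      {ω | hist alg U η m T ω ∈ A ∧ V ω ≤ Real.log T / 4}
      ((G T)ᶜ ∪ ((G T ∩ {ω | (T : ℝ) / 2 ≤ ∑ b ∈ Fᶜ, N b ω})
          ∪ (G T ∩ {ω | Real.log T / 4 ≤ V ω})))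
    have h8 := measureReal_union_le (μ := P) (G T)ᶜ
      ((G T ∩ {ω | (T : ℝ) / 2 ≤ ∑ b ∈ Fᶜ, N b ω}) ∪ (G T ∩ {ω | Real.log T / 4 ≤ V ω}))
    have h9 := measureReal_union_le (μ := P)
      (G T ∩ {ω | (T : ℝ) / 2 ≤ ∑ b ∈ Fᶜ, N b ω}) (G T ∩ {ω | Real.log T / 4 ≤ V ω})
    linarith
  -- hence `A` is not too unlikely under the alternative parameter
  have e4 : 1 / 4 ≤ Real.exp (Real.log T / 4)
      * P.real {ω | hist alg U η (fun b => m b + δ b) T ω ∈ A} := by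
    have h6 := ENNReal.toReal_mono (by finiteness)
      (hM.measure_hist_le_add hR alg m δ T (Real.log T / 4) hAm)
    rw [ENNReal.toReal_add (by finiteness) (by finiteness), ENNReal.toReal_mul,
      ENNReal.toReal_ofReal (Real.exp_pos _).le, ENNReal.toReal_ofReal (by norm_num)] at h6
    change P.real _ ≤ _ * P.real _ + _ at h6
    have h7 := e3.trans h6
    linarith
  -- which contradicts consistency there
  have e5 : gap x θ a * ((T : ℝ) / 2 * P.real {ω | hist alg U η (fun b => m b + δ b) T ω ∈ A})
      ≤ regret x alg P U η (θ + u) T := by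
    rw [hM.regret_eq, hm']
    have h6 := mul_meas_ge_le_integral_of_nonneg (μ := P)
      (f := fun ω => ∑ b ∈ F, pulls (hist alg U η (fun b => m b + δ b) T ω) b)
      (ae_of_all _ fun ω => Finset.sum_nonneg fun b _ => pulls_nonneg _ _)
      (integrable_finsetSum _ fun b _ => hM.integrable_pulls alg _ T b) (T / 2)
    rw [integral_finsetSum _ fun b _ => hM.integrable_pulls alg _ T b] at h6
    refine (mul_le_mul_of_nonneg_left h6 hga.le).trans ?_
    rw [Finset.mul_sum]
    refine (Finset.sum_le_sum fun b hb => mul_le_mul_of_nonneg_right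
      (gap_add_ge x θ ha (Finset.mem_filter.1 hb).2.1 (Finset.mem_filter.1 hb).2.2)
      (integral_nonneg fun ω => pulls_nonneg _ _)).trans ?_
    exact Finset.sum_le_sum_of_subset_of_nonneg (Finset.subset_univ _) fun b _ _ =>
      mul_nonneg (gap_nonneg x _ b) (integral_nonneg fun ω => pulls_nonneg _ _)
  have e6 : regret x alg P U η (θ + u) T ≤ (T : ℝ) ^ (1 / 2 : ℝ) := by
    refine (le_abs_self _).trans ?_
    rw [Real.norm_eq_abs, Real.norm_of_nonneg (by positivity), one_mul] at h3
    exact h3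
  set p := P.real {ω | hist alg U η (fun b => m b + δ b) T ω ∈ A}
  set y := (T : ℝ) ^ (1 / 4 : ℝ) with hy
  have hy0 : 0 < y := by positivity
  have hy1 : Real.exp (Real.log T / 4) = y := by
    rw [hy, Real.rpow_def_of_pos hT0]
    congr 1
    ring
  have hy2 : (T : ℝ) ^ (1 / 2 : ℝ) = y ^ 2 := by
    rw [hy, ← Real.rpow_natCast, ← Real.rpow_mul hT0.le]
    norm_num
  have hy4 : (T : ℝ) = y ^ 4 := by
    rw [hy, ← Real.rpow_natCast, ← Real.rpow_mul hT0.le]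
    norm_num
  rw [hy1] at e4
  rw [hy2] at e6
  have h6 := e5.trans e6
  rw [hy4] at h6
  -- By `e4` the probability `p` is at least `1 / (4 * y)` with `y = T ^ (1/4)`: the regret is at
  -- least of order `y ^ 3`, against the bound `y ^ 2` from consistency.
  have h7 : gap x θ a * (y ^ 3 / 8) ≤ gap x θ a * (y ^ 4 / 2 * p) := by
    refine mul_le_mul_of_nonneg_left ?_ hga.le
    have : 0 ≤ y ^ 3 := by positivity
    nlinarith
  have h8 : y ^ 2 * 1 < y ^ 2 * (gap x θ a / 8 * y) :=
    mul_lt_mul_of_pos_left h4 (by positivity)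
  nlinarith

end

/-! ### Uniformity over alternatives, by compactness along an ultrafilter. -/

lemma exists_tendsto_of_abs_le {ι : Type*} (𝒰 : Ultrafilter ι) {f : ι → ℝ} {C : ℝ}
    (h : ∀ᶠ i in 𝒰, |f i| ≤ C) : ∃ l, Tendsto f 𝒰 (nhds l) := by
  obtain ⟨l, _, hl⟩ := (isCompact_Icc (a := -C) (b := C)).ultrafilter_le_nhds (𝒰.map f)
    (by
      rw [Ultrafilter.coe_map, le_principal_iff, mem_map]
      filter_upwards [h] with i hi using abs_le.1 hi)
  exact ⟨l, hl⟩

lemma exists_tendsto_or_tendsto_atTop {ι : Type*} (𝒰 : Ultrafilter ι) {f : ι → ℝ}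
    (h : ∀ i, 0 ≤ f i) : (∃ l, Tendsto f 𝒰 (nhds l)) ∨ Tendsto f 𝒰 atTop := by
  by_cases hb : ∃ C, ∀ᶠ i in 𝒰, f i ≤ C
  · obtain ⟨C, hC⟩ := hb
    left
    refine exists_tendsto_of_abs_le 𝒰 (C := C) ?_
    filter_upwards [hC] with i hi
    rwa [abs_of_nonneg (h i)]
  · right
    refine tendsto_atTop.2 fun C => ?_
    have h1 := Ultrafilter.eventually_not.2 fun h' => hb ⟨C, h'⟩
    filter_upwards [h1] with i hi using (not_le.1 hi).le

/-- For quadratic forms `∑ b, n T b * (x b ⬝ᵥ u) ^ 2` indexed by `T`, an eventual lower bound at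
every fixed point of an affine hyperplane `x a ⬝ᵥ u = r` is eventually uniform, up to an arbitrarily
small loss. -/
lemma eventually_forall_lt_sum_sq {d K : ℕ} (x : Fin K → Fin d → ℝ) (a : Fin K) (r : ℝ)
    {n : ℕ → Fin K → ℝ} (hn : ∀ T b, 0 ≤ n T b) {c c' : ℝ} (hcc : c < c')
    (h : ∀ u, x a ⬝ᵥ u = r → ∀ᶠ T in atTop, c' < ∑ b, (x b ⬝ᵥ u) ^ 2 * n T b) :
    ∀ᶠ T in atTop, ∀ u, x a ⬝ᵥ u = r → c < ∑ b, (x b ⬝ᵥ u) ^ 2 * n T b := by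
  classical
  by_contra hcon
  rw [not_eventually] at hcon
  push Not at hcon
  set s : Set ℕ := {T | ∃ u, x a ⬝ᵥ u = r ∧ ∑ b, (x b ⬝ᵥ u) ^ 2 * n T b ≤ c}
  have : NeBot (atTop ⊓ 𝓟 s) := frequently_iff_neBot.1 hcon
  set 𝒰 := Ultrafilter.of (atTop ⊓ 𝓟 s)
  have h𝒰 : (𝒰 : Filter ℕ) ≤ atTop := (Ultrafilter.of_le _).trans inf_le_left
  have hs : ∀ᶠ T in 𝒰, ∃ u, x a ⬝ᵥ u = r ∧ ∑ b, (x b ⬝ᵥ u) ^ 2 * n T b ≤ c :=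
    (Ultrafilter.of_le _).trans inf_le_right (mem_principal_self s)
  have hs' : ∀ T, ∃ u : Fin d → ℝ, (∃ u, x a ⬝ᵥ u = r ∧ ∑ b, (x b ⬝ᵥ u) ^ 2 * n T b ≤ c) →
      x a ⬝ᵥ u = r ∧ ∑ b, (x b ⬝ᵥ u) ^ 2 * n T b ≤ c := by
    intro T
    by_cases hT : ∃ u, x a ⬝ᵥ u = r ∧ ∑ b, (x b ⬝ᵥ u) ^ 2 * n T b ≤ c
    · exact hT.imp fun u hu _ => hu
    · exact ⟨0, fun h => absurd h hT⟩
  choose u hu using hs'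
  replace hu : ∀ᶠ T in 𝒰, x a ⬝ᵥ u T = r ∧ ∑ b, (x b ⬝ᵥ u T) ^ 2 * n T b ≤ c := by
    filter_upwards [hs] with T hT using hu T hT
  have hub : ∀ b, ∀ᶠ T in 𝒰, (x b ⬝ᵥ u T) ^ 2 * n T b ≤ c := by
    intro b
    filter_upwards [hu] with T hT
    exact (Finset.single_le_sum (f := fun b => (x b ⬝ᵥ u T) ^ 2 * n T b)
      (fun b _ => mul_nonneg (sq_nonneg _) (hn T b)) (Finset.mem_univ b)).trans hT.2
  -- Only for these arms does the bound on the form keep `x b ⬝ᵥ u T` bounded; the points `u T`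
  -- themselves may be unbounded.
  set I : Finset (Fin K) := Finset.univ.filter fun b => ¬ Tendsto (fun T => n T b) 𝒰 (nhds 0)
  have hI : ∀ b ∈ I, ∃ C, ∀ᶠ T in 𝒰, |x b ⬝ᵥ u T| ≤ C := by
    intro b hb
    have hb' := (Finset.mem_filter.1 hb).2
    obtain ⟨ε, hε, he⟩ : ∃ ε > 0, ∀ᶠ T in 𝒰, ε ≤ n T b := by
      rcases exists_tendsto_or_tendsto_atTop 𝒰 fun T => hn T b with ⟨l, hl⟩ | hl
      · have hl0 : 0 ≤ l := ge_of_tendsto' hl fun T => hn T b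
        have hl1 : 0 < l := hl0.lt_of_ne (by rintro rfl; exact hb' hl)
        exact ⟨l / 2, by positivity,
          (hl.eventually_const_lt (by linarith : l / 2 < l)).mono fun T hT => hT.le⟩
      · exact ⟨1, one_pos, hl.eventually_ge_atTop 1⟩
    refine ⟨√(c / ε), ?_⟩
    filter_upwards [hub b, he] with T h1 h2
    refine Real.abs_le_sqrt ?_
    rw [le_div_iff₀ hε]
    exact (mul_le_mul_of_nonneg_left h2 (sq_nonneg _)).trans h1
  have hlim : ∀ b, ∃ l, Tendsto (fun T => if b ∈ I then x b ⬝ᵥ u T else 0) 𝒰 (nhds l) := by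
    intro b
    by_cases hb : b ∈ I
    · simp only [hb, if_true]
      obtain ⟨C, hC⟩ := hI b hb
      exact exists_tendsto_of_abs_le 𝒰 hC
    · simp only [hb, if_false]
      exact ⟨0, tendsto_const_nhds⟩
  choose l hl using hlim
  -- Although `u T` need not converge, its coordinates under `Φ` do. The range of a linear map is
  -- closed in finite dimension, so the limit is attained at some `w`, a fixed alternative to which
  -- `h` applies.
  let Φ : (Fin d → ℝ) →ₗ[ℝ] ℝ × (Fin K → ℝ) :=
    { toFun := fun w => (x a ⬝ᵥ w, fun b => if b ∈ I then x b ⬝ᵥ w else 0)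
      map_add' := fun w w' => by
        refine Prod.ext (dotProduct_add (x a) w w') (funext fun b => ?_)
        by_cases hb : b ∈ I <;> simp [hb, dotProduct_add]
      map_smul' := fun k w => by
        refine Prod.ext (dotProduct_smul k (x a) w) (funext fun b => ?_)
        by_cases hb : b ∈ I <;> simp [hb, dotProduct_smul] }
  have hΦ : Tendsto (fun T => Φ (u T)) 𝒰 (nhds (r, l)) := by
    refine Tendsto.prodMk_nhds (tendsto_const_nhds.congr' ?_) (tendsto_pi_nhds.2 hl)
    filter_upwards [hu] with T hT using hT.1.symm
  have hclosed : IsClosed (LinearMap.range Φ : Set (ℝ × (Fin K → ℝ))) :=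
    Submodule.closed_of_finiteDimensional _
  obtain ⟨w, hw⟩ := hclosed.mem_of_tendsto hΦ (Eventually.of_forall fun T => ⟨u T, rfl⟩)
  have hwa : x a ⬝ᵥ w = r := congrArg Prod.fst hw
  have hwb : ∀ b ∈ I, Tendsto (fun T => x b ⬝ᵥ u T) 𝒰 (nhds (x b ⬝ᵥ w)) := by
    intro b hb
    have h1 : (if b ∈ I then x b ⬝ᵥ w else 0) = l b := congrFun (congrArg Prod.snd hw) b
    have h2 := hl b
    rw [← h1] at h2
    simpa only [hb, if_true] using h2
  -- in the limit, the arms with `n T b → 0` or `n T b → ∞` do not contribute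
  have key : ∀ b, ∃ L, Tendsto (fun T => (x b ⬝ᵥ w) ^ 2 * n T b) 𝒰 (nhds L) ∧
      ∀ ε > 0, ∀ᶠ T in 𝒰, L - ε ≤ (x b ⬝ᵥ u T) ^ 2 * n T b := by
    intro b
    by_cases hb : b ∈ I
    · rcases exists_tendsto_or_tendsto_atTop 𝒰 fun T => hn T b with ⟨L, hL⟩ | hL
      · refine ⟨_, hL.const_mul _, fun ε hε => ?_⟩
        have h1 := ((hwb b hb).pow 2).mul hL
        filter_upwards [h1.eventually_const_lt (sub_lt_self _ hε)] with T hT using hT.le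
      -- Otherwise this single term would tend to infinity, although the form stays below `c`.
      · have h0 : x b ⬝ᵥ w = 0 := by
          by_contra h0
          have h1 := ((hwb b hb).pow 2).pos_mul_atTop (by positivity) hL
          obtain ⟨T, hT1, hT2⟩ := ((h1.eventually_gt_atTop c).and (hub b)).exists
          exact absurd hT1 (not_lt.2 hT2)
        refine ⟨0, by simp [h0], fun ε hε => Eventually.of_forall fun T => ?_⟩
        have := mul_nonneg (sq_nonneg (x b ⬝ᵥ u T)) (hn T b)
        linarith
    · have h0 : Tendsto (fun T => n T b) 𝒰 (nhds 0) := by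
        by_contra h0
        exact hb (Finset.mem_filter.2 ⟨Finset.mem_univ _, h0⟩)
      refine ⟨0, by simpa using h0.const_mul ((x b ⬝ᵥ w) ^ 2), fun ε hε =>
        Eventually.of_forall fun T => ?_⟩
      have := mul_nonneg (sq_nonneg (x b ⬝ᵥ u T)) (hn T b)
      linarith
  choose L hL1 hL2 using key
  have hge : c' ≤ ∑ b, L b :=
    ge_of_tendsto (tendsto_finsetSum _ fun b _ => hL1 b)
      (((h w hwa).filter_mono h𝒰).mono fun T hT => hT.le)
  have hle : ∑ b, L b ≤ c := by
    refine le_of_forall_pos_le_add fun ε hε => ?_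
    obtain ⟨T, hT1, hT2⟩ := ((eventually_all.2 fun b => hL2 b (ε / (K + 1)) (by positivity)).and
      hu).exists
    have h1 := (Finset.sum_le_sum fun b (_ : b ∈ Finset.univ) => hT1 b).trans hT2.2
    rw [Finset.sum_sub_distrib, Finset.sum_const, Finset.card_univ, Fintype.card_fin,
      nsmul_eq_mul] at h1
    have h2 : (K : ℝ) * (ε / (K + 1)) ≤ ε := by
      rw [mul_div_assoc', div_le_iff₀ (by positivity)]
      nlinarith
    linarith
  linarith

/-! ### The optimization problem: feasibility, and the value on the standard basis. -/

section

variable {d K : ℕ} (x : Fin K → Fin d → ℝ) (θ : Fin d → ℝ)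

lemma dotProduct_designMatrix_mulVec (α : Fin K → ℝ) (w : Fin d → ℝ) :
    w ⬝ᵥ (designMatrix x α *ᵥ w) = ∑ b, (x b ⬝ᵥ w) ^ 2 * α b := by
  rw [designMatrix, Matrix.sum_mulVec, dotProduct_sum]
  refine Finset.sum_congr rfl fun b _ => ?_
  rw [Matrix.smul_mulVec, Matrix.vecMulVec_mulVec, dotProduct_smul, dotProduct_smul,
    dotProduct_comm w]
  simp only [smul_eq_mul, MulOpposite.smul_eq_mul_unop, MulOpposite.unop_op]
  ring

lemma isHermitian_designMatrix (α : Fin K → ℝ) : (designMatrix x α).IsHermitian := by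
  ext i j
  simp [designMatrix, Matrix.sum_apply, Matrix.vecMulVec_apply, mul_comm]

lemma exists_dotProduct_ne_zero (hx : Submodule.span ℝ (Set.range x) = ⊤) {w : Fin d → ℝ}
    (hw : w ≠ 0) : ∃ b, x b ⬝ᵥ w ≠ 0 := by
  by_contra! h
  refine hw (dotProduct_self_eq_zero.1 ?_)
  have h1 : ∀ y ∈ Submodule.span ℝ (Set.range x), y ⬝ᵥ w = 0 := by
    intro y hy
    induction hy using Submodule.span_induction with
    | mem y hy => obtain ⟨b, rfl⟩ := hy; exact h b
    | zero => exact zero_dotProduct w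
    | add y z _ _ hy hz => rw [add_dotProduct, hy, hz, add_zero]
    | smul k y _ hy => rw [smul_dotProduct, hy, smul_zero]
  exact h1 w (hx ▸ Submodule.mem_top)

/-- With `H` the design matrix and `q = x_aᵀ H⁻¹ x_a`, the minimum of `uᵀ H u` subject to `x a ⬝ᵥ u
= 2 * gap x θ a` is `4 * gap x θ a ^ 2 / q`, reached along `H⁻¹ x_a`. It exceeds `8` exactly when `q
< gap x θ a ^ 2 / 2`. -/
lemma feasible_of_lt_sum_sq (hx : Submodule.span ℝ (Set.range x) = ⊤) {α : Fin K → ℝ}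
    (hα : ∀ b, 0 ≤ α b) (hα0 : ∀ b, gap x θ b = 0 → 0 < α b)
    (h : ∀ a, 0 < gap x θ a → ∀ u, x a ⬝ᵥ u = 2 * gap x θ a → 8 < ∑ b, (x b ⬝ᵥ u) ^ 2 * α b) :
    Feasible x θ α := by
  have hscale : ∀ (k : ℝ) (w : Fin d → ℝ), ∑ b, (x b ⬝ᵥ (k • w)) ^ 2 * α b
      = k ^ 2 * ∑ b, (x b ⬝ᵥ w) ^ 2 * α b := by
    intro k w
    rw [Finset.mul_sum]
    refine Finset.sum_congr rfl fun b _ => ?_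
    rw [dotProduct_smul, smul_eq_mul]
    ring
  have hpd : (designMatrix x α).PosDef := by
    refine Matrix.PosDef.of_dotProduct_mulVec_pos (isHermitian_designMatrix x α) fun w hw => ?_
    rw [star_trivial, dotProduct_designMatrix_mulVec]
    have h0 : ∀ b, 0 ≤ (x b ⬝ᵥ w) ^ 2 * α b := fun b => mul_nonneg (sq_nonneg _) (hα b)
    obtain ⟨b, hb⟩ := exists_dotProduct_ne_zero x hx hw
    rcases (gap_nonneg x θ b).eq_or_lt with hg | hg
    · refine Finset.sum_pos' (fun b _ => h0 b) ⟨b, Finset.mem_univ b, ?_⟩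
      exact mul_pos (by positivity) (hα0 b hg.symm)
    -- If `b` is suboptimal, `w` is rescaled onto its hyperplane, where the form is at least `8`.
    · have h1 := h b hg ((2 * gap x θ b / (x b ⬝ᵥ w)) • w)
        (by rw [dotProduct_smul, smul_eq_mul, div_mul_cancel₀ _ hb])
      rw [hscale] at h1
      exact pos_of_mul_pos_right (lt_trans (by norm_num) h1) (sq_nonneg _)
  refine ⟨hα, hpd, fun a ha => ?_⟩
  set v := (designMatrix x α)⁻¹ *ᵥ x a with hv
  set q := x a ⬝ᵥ v with hq
  have hdv : designMatrix x α *ᵥ v = x a := by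
    rw [hv, Matrix.mulVec_mulVec, Matrix.mul_nonsing_inv _
      ((Matrix.isUnit_iff_isUnit_det _).1 hpd.isUnit), Matrix.one_mulVec]
  have hq2 : ∑ b, (x b ⬝ᵥ v) ^ 2 * α b = q := by
    rw [← dotProduct_designMatrix_mulVec, hdv, dotProduct_comm]
  rcases le_or_gt q 0 with hq0 | hq0
  · exact hq0.trans (by positivity)
  · have h1 := h a ha ((2 * gap x θ a / q) • v)
      (by rw [dotProduct_smul, smul_eq_mul, ← hq, div_mul_cancel₀ _ hq0.ne'])
    rw [hscale, hq2] at h1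
    have h2 : (2 * gap x θ a / q) ^ 2 * q = 4 * gap x θ a ^ 2 / q := by
      field_simp
      ring
    rw [h2, lt_div_iff₀ hq0] at h1
    linarith

lemma bddBelow_cost :
    BddBelow ((fun α : Fin K → ℝ => ∑ a, α a * (gap x θ a / 3)) '' {α | Feasible x θ α}) := by
  refine ⟨0, ?_⟩
  rintro _ ⟨α, hα, rfl⟩
  exact Finset.sum_nonneg fun a _ => mul_nonneg (hα.1 a) (by linarith [gap_nonneg x θ a])

lemma optValue_le {α : Fin K → ℝ} (hα : Feasible x θ α) :
    optValue x θ ≤ ∑ a, α a * (gap x θ a / 3) :=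
  csInf_le (bddBelow_cost x θ) ⟨α, hα, rfl⟩

lemma optValue_nonneg : 0 ≤ optValue x θ := by
  refine Real.sInf_nonneg ?_
  rintro _ ⟨α, hα, rfl⟩
  exact Finset.sum_nonneg fun a _ => mul_nonneg (hα.1 a) (by linarith [gap_nonneg x θ a])

/-- On the standard basis, the design matrix is diagonal. -/
lemma designMatrix_single (e : Fin K ≃ Fin d) (hx : ∀ a, x a = Pi.single (e a) 1)
    (α : Fin K → ℝ) : designMatrix x α = Matrix.diagonal fun i => α (e.symm i) := by
  ext i j
  simp only [designMatrix, Matrix.sum_apply, Matrix.smul_apply, Matrix.vecMulVec_apply, hx,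
    smul_eq_mul, Matrix.diagonal_apply]
  rw [Finset.sum_eq_single (e.symm i)]
  · by_cases hij : i = j
    · simp [hij]
    · simp [hij, Ne.symm hij]
  · intro b _ hb
    have : i ≠ e b := fun h => hb (by simp [h])
    simp [Pi.single_apply, this]
  · simp

lemma feasible_single_iff (e : Fin K ≃ Fin d) (hx : ∀ a, x a = Pi.single (e a) 1)
    (α : Fin K → ℝ) :
    Feasible x θ α ↔ (∀ a, 0 < α a) ∧ ∀ a, 0 < gap x θ a → 2 / gap x θ a ^ 2 ≤ α a := by
  have hpd : (designMatrix x α).PosDef ↔ ∀ a, 0 < α a := by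
    rw [designMatrix_single x e hx, Matrix.posDef_diagonal_iff]
    exact ⟨fun h a => by simpa using h (e a), fun h i => h _⟩
  have hinv : (∀ a, 0 < α a) → ∀ a, x a ⬝ᵥ ((designMatrix x α)⁻¹ *ᵥ x a) = (α a)⁻¹ := by
    intro hα a
    have hd : (designMatrix x α)⁻¹ = Matrix.diagonal fun i => (α (e.symm i))⁻¹ := by
      refine Matrix.inv_eq_right_inv ?_
      rw [designMatrix_single x e hx, Matrix.diagonal_mul_diagonal, ← Matrix.diagonal_one]
      congr 1
      funext i
      exact mul_inv_cancel₀ (hα _).ne'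
    rw [hd, hx, single_dotProduct, Matrix.mulVec_diagonal]
    simp
  have hcmp : ∀ a, 0 < α a → 0 < gap x θ a →
      ((α a)⁻¹ ≤ gap x θ a ^ 2 / 2 ↔ 2 / gap x θ a ^ 2 ≤ α a) := by
    intro a hα hg
    rw [inv_le_comm₀ hα (by positivity), inv_div]
  constructor
  · rintro ⟨_, h2, h3⟩
    have hα := hpd.1 h2
    refine ⟨hα, fun a ha => (hcmp a (hα a) ha).1 ?_⟩
    rw [← hinv hα a]
    exact h3 a ha
  · rintro ⟨hα, h2⟩
    refine ⟨fun a => (hα a).le, hpd.2 hα, fun a ha => ?_⟩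
    rw [hinv hα a]
    exact (hcmp a (hα a) ha).2 (h2 a ha)

/-- The optimal value for the `K`-armed bandit. -/
lemma optValue_single (e : Fin K ≃ Fin d) (hx : ∀ a, x a = Pi.single (e a) 1) :
    optValue x θ = ∑ a with 0 < gap x θ a, 2 / (3 * gap x θ a) := by
  have hα : ∀ a, 0 < gap x θ a →
      2 / gap x θ a ^ 2 * (gap x θ a / 3) = 2 / (3 * gap x θ a) := fun a ha => by
    field_simp
  refine le_antisymm ?_ ?_
  -- Optimal arms cost nothing, so their weight is arbitrary; it must be positive for the design
  -- matrix to be invertible.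
  · have hf : Feasible x θ fun a => if 0 < gap x θ a then 2 / gap x θ a ^ 2 else 1 := by
      rw [feasible_single_iff x θ e hx]
      refine ⟨fun a => ?_, fun a ha => by simp [ha]⟩
      split_ifs <;> positivity
    refine (optValue_le x θ hf).trans_eq ?_
    rw [Finset.sum_filter]
    refine Finset.sum_congr rfl fun a _ => ?_
    split_ifs with ha
    · exact hα a ha
    · rw [le_antisymm (not_lt.1 ha) (gap_nonneg x θ a)]
      simp
  · refine le_csInf ⟨_, (fun a => if 0 < gap x θ a then 2 / gap x θ a ^ 2 else 1), ?_, rfl⟩ ?_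
    · rw [Set.mem_ofPred_eq, feasible_single_iff x θ e hx]
      refine ⟨fun a => ?_, fun a ha => by simp [ha]⟩
      split_ifs <;> positivity
    · rintro _ ⟨α, hf, rfl⟩
      obtain ⟨h1, h2⟩ := (feasible_single_iff x θ e hx α).1 hf
      rw [Finset.sum_filter]
      refine Finset.sum_le_sum fun a _ => ?_
      split_ifs with ha
      · rw [← hα a ha]
        exact mul_le_mul_of_nonneg_right (h2 a ha) (by positivity)
      · exact mul_nonneg (h1 a).le (by linarith [gap_nonneg x θ a])

end

/-! ### Assembly: the cost of exploration and the total compensation. -/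

lemma ofReal_integral_le_lintegral {Ω : Type*} [MeasurableSpace Ω] {P : Measure Ω} {f : Ω → ℝ}
    (hf : Integrable f P) :
    ENNReal.ofReal (∫ ω, f ω ∂P) ≤ ∫⁻ ω, ENNReal.ofReal (f ω) ∂P := by
  have h1 : ∫ ω, f ω ∂P ≤ ∫ ω, max (f ω) 0 ∂P :=
    integral_mono hf hf.pos_part fun ω => le_max_left _ _
  refine (ENNReal.ofReal_le_ofReal h1).trans_eq ?_
  rw [ofReal_integral_eq_lintegral_ofReal hf.pos_part (ae_of_all _ fun ω => le_max_right _ _)]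
  refine lintegral_congr fun ω => ?_
  rcases le_total (f ω) 0 with h | h
  · rw [max_eq_right h, ENNReal.ofReal_of_nonpos h, ENNReal.ofReal_zero]
  · rw [max_eq_left h]

section

variable {d K : ℕ} {S Ω : Type*} [MeasurableSpace S] [MeasurableSpace Ω]
  {P : Measure Ω} {U : Ω → S} {η : ℕ → Ω → ℝ} {R : ℝ≥0}
  (hM : IsNoiseModel P U η R) (alg : Algorithm K S)
  (x : Fin K → Fin d → ℝ) (θ : Fin d → ℝ)

include hM

lemma IsNoiseModel.totalCompensation_eq {c : ℕ → Fin K → Ω → ℝ}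
    (hc : ∀ t i, Measurable (c t i)) (T : ℕ) :
    totalCompensation x alg P U η θ c T = ∫⁻ ω, ∑ t ∈ Finset.range T, ENNReal.ofReal
      (c t (arm alg (meanReward x θ) (U ω) (fun i => η i ω) t) ω) ∂P := by
  rw [lintegral_finsetSum]
  · rfl
  · intro t _
    refine Measurable.ennreal_ofReal ?_
    have h : Measurable fun p : Fin K × Ω => c t p.1 p.2 :=
      measurable_from_prod_countable_right fun i => hc t i
    exact h.comp ((hM.measurable_arm alg _ t).prodMk measurable_id)

variable [IsProbabilityMeasure P]

/-- A consistent algorithm has a logarithmic cost of suboptimal pulls, even on events of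
probability tending to one. -/
lemma IsNoiseModel.eventually_optValue_le (hR : R ≠ 0)
    (hx : Submodule.span ℝ (Set.range x) = ⊤) (hcons : IsConsistent x alg P U η)
    {G : ℕ → Set Ω} (hG : ∀ T, MeasurableSet (G T))
    (hGlim : Tendsto (fun T => P.real (G T)ᶜ) atTop (nhds 0)) :
    ∀ᶠ T : ℕ in atTop, (R : ℝ) ^ 2 / 144 * (optValue x θ * Real.log T)
      ≤ ∑ b, gap x θ b / 3 * ∫ ω in G T, pulls (hist alg U η (meanReward x θ) T ω) b ∂P := by
  have hR2 : (0 : ℝ) < (R : ℝ) ^ 2 := by positivity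
  set n : ℕ → Fin K → ℝ := fun T b =>
    (∫ ω in G T, pulls (hist alg U η (meanReward x θ) T ω) b ∂P) / Real.log T with hn
  have hn0 : ∀ T b, 0 ≤ n T b := fun T b =>
    div_nonneg (integral_nonneg fun ω => pulls_nonneg _ _) (Real.log_natCast_nonneg T)
  have hev : ∀ᶠ T in atTop, ∀ a, 0 < gap x θ a → ∀ u, x a ⬝ᵥ u = 2 * gap x θ a →
      (R : ℝ) ^ 2 / 18 < ∑ b, (x b ⬝ᵥ u) ^ 2 * n T b := by
    refine eventually_all.2 fun a => ?_
    by_cases ha : 0 < gap x θ a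
    · simp only [ha, true_imp_iff]
      -- Uniformity costs the passage from `16` to `18`; the factor `144` then gives exactly `144 /
      -- 18 = 8`.
      refine eventually_forall_lt_sum_sq x a _ hn0 (c' := (R : ℝ) ^ 2 / 16) (by linarith)
        fun u hu => ?_
      filter_upwards [hM.eventually_lt_information alg x θ hR hcons hG hGlim ha hu,
        eventually_gt_atTop 1] with T hT hT1
      have hlog : 0 < Real.log T := Real.log_pos (by exact_mod_cast hT1)
      simp only [hn, ← mul_div_assoc]
      rw [← Finset.sum_div, lt_div_iff₀ hlog]
      exact hT
    · simp [ha]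
  filter_upwards [hev, eventually_gt_atTop 1] with T hT hT1
  have hlog : 0 < Real.log T := Real.log_pos (by exact_mod_cast hT1)
  -- The extra weight on optimal arms leaves the cost unchanged and ensures positive definiteness.
  set α : Fin K → ℝ := fun b => 144 / (R : ℝ) ^ 2 * n T b + if gap x θ b = 0 then 1 else 0 with hα
  have hα1 : ∀ b, 144 / (R : ℝ) ^ 2 * n T b ≤ α b := fun b => by
    simp only [hα]
    split_ifs <;> simp
  have hα2 : ∀ b, 0 ≤ 144 / (R : ℝ) ^ 2 * n T b := fun b => mul_nonneg (by positivity) (hn0 T b)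
  have hfeas : Feasible x θ α := by
    refine feasible_of_lt_sum_sq x θ hx (fun b => (hα2 b).trans (hα1 b)) (fun b hb => ?_)
      fun a ha u hu => ?_
    · simp only [hα, hb, if_true]
      linarith [hα2 b]
    · have h1 := mul_lt_mul_of_pos_left (hT a ha u hu) (by positivity : 0 < 144 / (R : ℝ) ^ 2)
      have h2 : 144 / (R : ℝ) ^ 2 * ((R : ℝ) ^ 2 / 18) = 8 := by
        field_simp
        norm_num
      rw [h2, Finset.mul_sum] at h1
      refine h1.trans_le (Finset.sum_le_sum fun b _ => ?_)
      rw [mul_left_comm]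
      exact mul_le_mul_of_nonneg_left (hα1 b) (sq_nonneg _)
  have hopt := optValue_le x θ hfeas
  have hcost : ∑ b, α b * (gap x θ b / 3) = 144 / (R : ℝ) ^ 2 / Real.log T * ∑ b, gap x θ b / 3
      * ∫ ω in G T, pulls (hist alg U η (meanReward x θ) T ω) b ∂P := by
    rw [Finset.mul_sum]
    refine Finset.sum_congr rfl fun b _ => ?_
    by_cases hb : gap x θ b = 0
    · simp [hb]
    · simp only [hα, hb, if_false, add_zero, hn]
      ring
  rw [hcost] at hopt
  set X := ∑ b, gap x θ b / 3
    * ∫ ω in G T, pulls (hist alg U η (meanReward x θ) T ω) b ∂P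
  calc (R : ℝ) ^ 2 / 144 * (optValue x θ * Real.log T)
      ≤ (R : ℝ) ^ 2 / 144 * (144 / (R : ℝ) ^ 2 / Real.log T * X * Real.log T) := by gcongr
    _ = X := by field_simp

/-- Half of the exploration cost `2 * A * log T` pays for the exceptional rounds; the other half is
the bound. -/
lemma IsNoiseModel.eventually_le_totalCompensation (hR : R ≠ 0)
    (hx : Submodule.span ℝ (Set.range x) = ⊤) (hcons : IsConsistent x alg P U η)
    {lam : ℝ} (hlam : 0 < lam) {c : ℕ → Fin K → Ω → ℝ} (hc : ∀ t i, Measurable (c t i))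
    (hinc : Incentivizes x lam alg P U η θ c) :
    ∀ᶠ T : ℕ in atTop, ENNReal.ofReal ((R : ℝ) ^ 2 / 288 * (optValue x θ * Real.log T))
      ≤ totalCompensation x alg P U η θ c T := by
  rcases (optValue_nonneg x θ).eq_or_lt with h0 | h0
  · simp [← h0]
  have hR0 : (0 : ℝ) < R := by positivity
  set m := meanReward x θ with hm
  obtain ⟨D, hD, hDg⟩ := exists_forall_le_of_pos (gap x θ)
  obtain ⟨M, hM0, hMg⟩ := exists_forall_gap_le x θ
  set A : ℝ := (R : ℝ) ^ 2 / 288 * optValue x θ with hA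
  have hA0 : 0 < A := by positivity
  -- `ε₂` makes the initial `T₁` rounds cheap, `M * ε₂ ≤ A`. Then `ε₁` makes the noise level so low
  -- that, for large `T`, the required pull count satisfies `2 * K * q < T₁`.
  set ε₂ : ℝ := A / (M + 1) with hε₂
  have hε₂0 : 0 < ε₂ := by positivity
  set ε₁ : ℝ := ε₂ * D ^ 2 / (36 * (K + 1) ^ 2) with hε₁
  have hε₁0 : 0 < ε₁ := by positivity
  set κ : ℝ := lam * (θ ⬝ᵥ θ) with hκ
  have hκ0 : 0 ≤ κ := mul_nonneg hlam.le (Finset.sum_nonneg fun i _ => mul_self_nonneg _)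
  have hlog : Tendsto (fun T : ℕ => Real.log T) atTop atTop :=
    Real.tendsto_log_atTop.comp tendsto_natCast_atTop_atTop
  set G : ℕ → Set Ω := fun T => goodEvent alg x θ U η (ε₁ * Real.log T) T ⌊ε₂ * Real.log T⌋₊
  have hG : ∀ T, MeasurableSet (G T) := fun T => hM.measurableSet_goodEvent alg x θ _ _ _
  filter_upwards [hM.eventually_optValue_le alg x θ hR hx hcons hG
      (hM.tendsto_goodEvent_compl alg x θ hR hcons hε₁0 hε₂0),
    hlog.eventually_gt_atTop 0,
    (hlog.const_mul_atTop (half_pos hε₂0)).eventually_gt_atTop (18 * K * κ / D ^ 2 + 1),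
    (hlog.const_mul_atTop hA0).eventually_ge_atTop (M * K)] with T h1 h2 h3 h4
  set β := ε₁ * Real.log T with hβ
  have hβ0 : 0 < β := by positivity
  set T₁ := ⌊ε₂ * Real.log T⌋₊ with hT₁
  set q : ℝ := 9 * (K * β + κ) / D ^ 2 with hq
  have hq0 : 0 ≤ q := by positivity
  have hqD : 9 * (K * β + κ) ≤ q * D ^ 2 := by
    rw [hq, div_mul_cancel₀ _ (by positivity)]
  have hT₁le : (T₁ : ℝ) ≤ ε₂ * Real.log T := Nat.floor_le (by positivity)
  have hqT : 2 * (K * q) < T₁ := by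
    have e1 : ε₂ * Real.log T < T₁ + 1 := Nat.lt_floor_add_one _
    have e2 : 2 * (K * q) = 18 * K ^ 2 * β / D ^ 2 + 18 * K * κ / D ^ 2 := by
      rw [hq]
      ring
    have e3 : 18 * K ^ 2 * β / D ^ 2 ≤ ε₂ / 2 * Real.log T := by
      have : 18 * K ^ 2 * β / D ^ 2
          = ε₂ / 2 * Real.log T * ((K : ℝ) ^ 2 / (K + 1) ^ 2) := by
        rw [hβ, hε₁]
        field_simp
        ring
      rw [this]
      refine mul_le_of_le_one_right (by positivity) ?_
      rw [div_le_one (by positivity)]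
      gcongr
      linarith
    linarith
  set B : ℝ := M / 3 * (T₁ + K * (q + 1)) with hB
  have hB0 : 0 ≤ B := by positivity
  have hBle : B ≤ A * Real.log T := by
    have e1 : M * ε₂ ≤ A := by
      rw [hε₂, mul_div_assoc', div_le_iff₀ (by positivity)]
      nlinarith
    have e2 : M * (ε₂ * Real.log T) ≤ A * Real.log T := by
      rw [← mul_assoc]
      gcongr
    have e3 : M * (T₁ + K * (q + 1)) ≤ M * (2 * (ε₂ * Real.log T) + K) :=
      mul_le_mul_of_nonneg_left (by linarith) hM0
    rw [hB]
    linarith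
  set f : Ω → ℝ := fun ω => ∑ b, gap x θ b / 3 * pulls (hist alg U η m T ω) b - B with hf
  have hsumint : Integrable (fun ω => ∑ b, gap x θ b / 3 * pulls (hist alg U η m T ω) b) P :=
    integrable_finsetSum _ fun b _ => (hM.integrable_pulls alg m T b).const_mul (gap x θ b / 3)
  have hfint : Integrable f P := hsumint.sub (integrable_const B)
  have hint : (R : ℝ) ^ 2 / 288 * (optValue x θ * Real.log T) ≤ ∫ ω in G T, f ω ∂P := by
    have e1 : ∫ ω in G T, f ω ∂P = (∑ b, gap x θ b / 3
        * ∫ ω in G T, pulls (hist alg U η m T ω) b ∂P) - P.real (G T) * B := by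
      rw [hf, integral_sub hsumint.integrableOn (integrable_const B).integrableOn,
        integral_finsetSum _ fun b _ =>
          ((hM.integrable_pulls alg m T b).const_mul (gap x θ b / 3)).integrableOn]
      simp [integral_const_mul]
    have e2 : P.real (G T) * B ≤ B := mul_le_of_le_one_left hB0 measureReal_le_one
    have e3 : (R : ℝ) ^ 2 / 144 * (optValue x θ * Real.log T) = 2 * (A * Real.log T) := by
      rw [hA]
      ring
    rw [e3] at h1
    rw [e1, ← mul_assoc]
    linarith
  calc ENNReal.ofReal ((R : ℝ) ^ 2 / 288 * (optValue x θ * Real.log T))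
      ≤ ENNReal.ofReal (∫ ω in G T, f ω ∂P) := ENNReal.ofReal_le_ofReal hint
    -- The pathwise bound `f` may be negative; truncating it at zero only increases the integral.
    _ ≤ ∫⁻ ω in G T, ENNReal.ofReal (f ω) ∂P := ofReal_integral_le_lintegral hfint.integrableOn
    _ ≤ ∫⁻ ω in G T, ∑ t ∈ Finset.range T, ENNReal.ofReal
          (c t (arm alg m (U ω) (fun i => η i ω) t) ω) ∂P := by
        refine lintegral_mono_ae ((ae_restrict_iff' (hG T)).2 ?_)
        filter_upwards [hinc] with ω hω hωG
        rw [← ENNReal.ofReal_sum_of_nonneg fun t _ => (hω t).1 _]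
        refine ENNReal.ofReal_le_ofReal ?_
        refine le_sum_compensation x θ alg (U ω) (fun i => η i ω) hlam hβ0.le hD hDg hMg hqD hq0
          hqT hωG.2 hωG.1 (c := fun t => c t (arm alg m (U ω) (fun i => η i ω) t) ω)
          (fun t => (hω t).1 _) fun t i => ?_
        have e1 := (hω t).1 i
        have e2 := (hω t).2 i
        linarith
    _ ≤ ∫⁻ ω, ∑ t ∈ Finset.range T, ENNReal.ofReal
          (c t (arm alg m (U ω) (fun i => η i ω) t) ω) ∂P := setLIntegral_le_lintegral _ _
    _ = totalCompensation x alg P U η θ c T := (hM.totalCompensation_eq alg x θ hc T).symm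

end

end

end IncentivizedBandit

theorem mainTheorem4 (R : ℝ≥0) (hR : R ≠ 0) :
    ∃ κ : ℝ, 0 < κ ∧
      ∀ (d K : ℕ) (x : Fin K → Fin d → ℝ), Submodule.span ℝ (Set.range x) = ⊤ →
      ∀ (S Ω : Type*) [MeasurableSpace S] [MeasurableSpace Ω]
        (P : Measure Ω) [IsProbabilityMeasure P]
        (U : Ω → S) (η : ℕ → Ω → ℝ),
        Measurable U → (∀ t, Measurable (η t)) →
        iIndepFun η P → (∀ t, P.map (η t) = gaussianReal 0 (R ^ 2)) →
        IndepFun U (fun ω t => η t ω) P →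
      ∀ alg : IncentivizedBandit.Algorithm K S,
        IncentivizedBandit.IsConsistent x alg P U η →
      ∀ (θ : Fin d → ℝ) (lam : ℝ), 0 < lam →
      ∀ c : ℕ → Fin K → Ω → ℝ, (∀ t i, Measurable (c t i)) →
        IncentivizedBandit.Incentivizes x lam alg P U η θ c →
        (∀ᶠ T : ℕ in atTop,
          ENNReal.ofReal (κ * (IncentivizedBandit.optValue x θ * Real.log T)) ≤
            IncentivizedBandit.totalCompensation x alg P U η θ c T) ∧
        (∀ e : Fin K ≃ Fin d, (∀ a, x a = Pi.single (e a) 1) →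
          IncentivizedBandit.optValue x θ =
            ∑ a with 0 < IncentivizedBandit.gap x θ a,
              2 / (3 * IncentivizedBandit.gap x θ a) ∧
          ∀ᶠ T : ℕ in atTop,
            ENNReal.ofReal (κ * ∑ a with 0 < IncentivizedBandit.gap x θ a,
              Real.log T / IncentivizedBandit.gap x θ a) ≤
              IncentivizedBandit.totalCompensation x alg P U η θ c T) := by
  have hR0 : (0 : ℝ) < R := by positivity
  -- On the standard basis `optValue` carries a factor `2 / 3`, and `288 * 3 / 2 = 432`; the general
  -- bound holds with the larger `R ^ 2 / 288`.
  refine ⟨(R : ℝ) ^ 2 / 432, by positivity, ?_⟩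
  intro d K x hx S Ω _ _ P _ U η hU hη hind hlaw hseed alg hcons θ lam hlam c hc hinc
  have hM : IncentivizedBandit.IsNoiseModel P U η R := ⟨hU, hη, hind, hlaw, hseed⟩
  have hmain := hM.eventually_le_totalCompensation alg x θ hR hx hcons hlam hc hinc
  refine ⟨?_, fun e he => ?_⟩
  · filter_upwards [hmain] with T hT
    refine (ENNReal.ofReal_le_ofReal ?_).trans hT
    refine mul_le_mul_of_nonneg_right ?_
      (mul_nonneg (IncentivizedBandit.optValue_nonneg x θ) (Real.log_natCast_nonneg T))
    gcongr
    norm_num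
  · have hopt := IncentivizedBandit.optValue_single x θ e he
    refine ⟨hopt, ?_⟩
    filter_upwards [hmain] with T hT
    refine (ENNReal.ofReal_le_ofReal (le_of_eq ?_)).trans hT
    rw [hopt, Finset.sum_mul, Finset.mul_sum, Finset.mul_sum]
    refine Finset.sum_congr rfl fun a ha => ?_
    have hg : IncentivizedBandit.gap x θ a ≠ 0 := (Finset.mem_filter.1 ha).2.ne'
    field_simp
    ring
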